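/- Let $T$ be a string of length $n\ge 1$ over the alphabet $\{1,\dots,n^{c}\}$ for a constant $c$. For $k\ge 1$ let $S_T(k)$ be the number of distinct substrings (contiguous factors) of $T$ of length $k$, and let $\delta=\sup\{S_T(k)/k : k\ge 1\}$. Then there is a deterministic algorithm that, given read-only random access to $T$, together with $n$ and any integer $b\in[1,n]$, computes $\delta$ (exactly, as a fraction of two integers) in $\mathcal{O}(n^3/b)$ time using $\mathcal{O}(b)$ words of working space. Within the same bounds it also outputs all the values $S_T(1),\dots,S_T(n)$. The model is the unit-cost word RAM with words of $\mathcal{O}(\log (n+1))$ bits, a read-only input and a write-only output, neither of which counts as working space. The algorithm and the constants in the time and space bounds are the same for all $T$, $n$, $b$ and $c$; the constant in the word length depends only on $c$. -/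

import Mathlib

/-! ### Substring complexity -/

/-- `S_T(k)`: the number of distinct substrings (contiguous factors) of length `k` of `T`. -/
noncomputable def substringComplexity (T : List ℕ) (k : ℕ) : ℕ :=
  {u : List ℕ | u.length = k ∧ u <:+: T}.ncard

/-- `δ(T) = sup {S_T(k) / k : k ≥ 1}`. The set is nonempty and bounded, see `isLUB_delta`. -/
noncomputable def delta (T : List ℕ) : ℝ :=
  sSup {x : ℝ | ∃ k : ℕ, 1 ≤ k ∧ x = (substringComplexity T k : ℝ) / k}

theorem substringComplexity_le (T : List ℕ) (k : ℕ) :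
    substringComplexity T k ≤ T.length + 1 := by
  have hsub : {u : List ℕ | u.length = k ∧ u <:+: T} ⊆
      (((Finset.range (T.length + 1)).image fun i => (T.drop i).take k : Finset (List ℕ)) :
        Set (List ℕ)) := by
    rintro u ⟨hk, s, t, rfl⟩
    simp only [Finset.coe_image, Set.mem_image, Finset.coe_range, Set.mem_Iio]
    refine ⟨s.length, by simp only [List.length_append]; omega, ?_⟩
    subst hk
    simp
  calc substringComplexity T k ≤ _ := Set.ncard_le_ncard hsub (Finset.finite_toSet _)
    _ ≤ _ := by
      rw [Set.ncard_coe_finset]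
      exact Finset.card_image_le.trans (by simp)

theorem isLUB_delta (T : List ℕ) :
    IsLUB {x : ℝ | ∃ k : ℕ, 1 ≤ k ∧ x = (substringComplexity T k : ℝ) / k} (delta T) := by
  refine isLUB_csSup ⟨_, 1, le_rfl, rfl⟩ ⟨(T.length + 1 : ℕ), ?_⟩
  rintro x ⟨k, hk, rfl⟩
  have h1 : (1 : ℝ) ≤ k := by exact_mod_cast hk
  exact (div_le_self (Nat.cast_nonneg _) h1).trans
    (by exact_mod_cast substringComplexity_le T k)

/-! ### A unit-cost word RAM

The machine has a read-only input string, a write-only output stream, a random-access working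
memory and the finitely many registers that its (fixed) program mentions. Every word has `w` bits,
and only the memory cells with address less than `M` may be used. A program is a structured
(`while`) program; every operation costs one time unit. -/

namespace WordRAM

/-- The binary word operations. Subtraction is truncated at `0`; comparisons return `0` or `1`. -/
inductive Op
  | add | sub | mul | div | mod | lt | eq

/-- The result of a word operation, as a natural number. -/
def Op.eval : Op → ℕ → ℕ → ℕ
  | .add, x, y => x + y
  | .sub, x, y => x - y
  | .mul, x, y => x * y
  | .div, x, y => x / y
  | .mod, x, y => x % y
  | .lt, x, y => if x < y then 1 else 0
  | .eq, x, y => if x = y then 1 else 0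

/-- Expressions: constants, registers, memory cells, input letters (positions counted from `0`)
and word operations. -/
inductive Expr
  | const (c : ℕ)
  | reg (r : ℕ)
  | mem (addr : Expr)
  | input (pos : Expr)
  | op (o : Op) (e₁ e₂ : Expr)

/-- The number of nodes of an expression; it is the time needed to evaluate it. -/
def Expr.size : Expr → ℕ
  | .const _ => 1
  | .reg _ => 1
  | .mem e => e.size + 1
  | .input e => e.size + 1
  | .op _ e₁ e₂ => e₁.size + e₂.size + 1

/-- Programs. Conditions are expressions, a nonzero value means "true". -/
inductive Prog
  | skip
  | assign (r : ℕ) (e : Expr)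
  | store (addr e : Expr)
  | output (e : Expr)
  | seq (P Q : Prog)
  | ite (e : Expr) (P Q : Prog)
  | loop (e : Expr) (P : Prog)

/-- The size of the program text. In particular, it bounds the number of registers that occur in
the program and the number of words needed for intermediate values of expressions. -/
def Prog.size : Prog → ℕ
  | .skip => 1
  | .assign _ e => e.size + 1
  | .store a e => a.size + e.size + 1
  | .output e => e.size + 1
  | .seq P Q => P.size + Q.size + 1
  | .ite e P Q => e.size + P.size + Q.size + 1
  | .loop e P => e.size + P.size + 1

/-- Contents of the registers and of the working memory, and the output written so far. -/
structure State where
  reg : ℕ → ℕ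
  mem : ℕ → ℕ
  out : List ℕ

/-- The initial state: register `0` holds the length `n` of the input, register `1` holds the
parameter `b`; everything else is `0`, and nothing has been written. -/
def State.init (n b : ℕ) : State where
  reg := fun r => if r = 0 then n else if r = 1 then b else 0
  mem := fun _ => 0
  out := []

/-- The value of an expression, for the input `T`, in the state `s`. -/
def Expr.val (T : List ℕ) (s : State) : Expr → ℕ
  | .const c => c
  | .reg r => s.reg r
  | .mem e => s.mem (e.val T s)
  | .input e => T.getD (e.val T s) 0
  | .op o e₁ e₂ => o.eval (e₁.val T s) (e₂.val T s)

/-- An expression is legal in a state if its evaluation creates only words of `w` bits, uses only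
memory cells with address less than `M`, and reads the input only within its bounds. -/
def Expr.Legal (w M : ℕ) (T : List ℕ) (s : State) : Expr → Prop
  | .const c => c < 2 ^ w
  | .reg _ => True
  | .mem e => e.Legal w M T s ∧ e.val T s < M
  | .input e => e.Legal w M T s ∧ e.val T s < T.length
  | .op o e₁ e₂ =>
      e₁.Legal w M T s ∧ e₂.Legal w M T s ∧ o.eval (e₁.val T s) (e₂.val T s) < 2 ^ w

/-- `Exec w M T P s s' t`: on a machine with words of `w` bits and `M` memory cells, and with the
read-only input `T`, the program `P` started in the state `s` halts in the state `s'` after exactly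
`t` time units, all of its operations being legal. A program that performs an illegal operation
(overflow, address out of range) is stuck and has no such execution. -/
inductive Exec (w M : ℕ) (T : List ℕ) : Prog → State → State → ℕ → Prop
  | skip (s : State) : Exec w M T .skip s s 1
  | assign (r : ℕ) (e : Expr) (s : State) (he : e.Legal w M T s) :
      Exec w M T (.assign r e) s { s with reg := Function.update s.reg r (e.val T s) }
        (e.size + 1)
  | store (a e : Expr) (s : State) (ha : a.Legal w M T s) (haM : a.val T s < M)
      (he : e.Legal w M T s) :
      Exec w M T (.store a e) s
        { s with mem := Function.update s.mem (a.val T s) (e.val T s) } (a.size + e.size + 1)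
  | output (e : Expr) (s : State) (he : e.Legal w M T s) :
      Exec w M T (.output e) s { s with out := s.out ++ [e.val T s] } (e.size + 1)
  | seq (P Q : Prog) (s s₁ s₂ : State) (t₁ t₂ : ℕ) (hP : Exec w M T P s s₁ t₁)
      (hQ : Exec w M T Q s₁ s₂ t₂) : Exec w M T (.seq P Q) s s₂ (t₁ + t₂)
  | ite_true (e : Expr) (P Q : Prog) (s s' : State) (t : ℕ) (he : e.Legal w M T s)
      (h : e.val T s ≠ 0) (hP : Exec w M T P s s' t) :
      Exec w M T (.ite e P Q) s s' (e.size + 1 + t)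
  | ite_false (e : Expr) (P Q : Prog) (s s' : State) (t : ℕ) (he : e.Legal w M T s)
      (h : e.val T s = 0) (hQ : Exec w M T Q s s' t) :
      Exec w M T (.ite e P Q) s s' (e.size + 1 + t)
  | loop_false (e : Expr) (P : Prog) (s : State) (he : e.Legal w M T s) (h : e.val T s = 0) :
      Exec w M T (.loop e P) s s (e.size + 1)
  | loop_true (e : Expr) (P : Prog) (s s₁ s₂ : State) (t₁ t₂ : ℕ) (he : e.Legal w M T s)
      (h : e.val T s ≠ 0) (hP : Exec w M T P s s₁ t₁) (hL : Exec w M T (.loop e P) s₁ s₂ t₂) :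
      Exec w M T (.loop e P) s s₂ (e.size + 1 + t₁ + t₂)

/-- The machine is deterministic: the result and the running time are determined by the program
and the initial state. -/
theorem Exec.unique {w M : ℕ} {T : List ℕ} {P : Prog} {s s₁ s₂ : State} {t₁ t₂ : ℕ}
    (h₁ : Exec w M T P s s₁ t₁) (h₂ : Exec w M T P s s₂ t₂) : s₁ = s₂ ∧ t₁ = t₂ := by
  induction h₁ generalizing s₂ t₂ with
  | skip | assign | store | output => cases h₂; exact ⟨rfl, rfl⟩
  | seq P Q s a b u v hP hQ ihP ihQ =>
    cases h₂ with
    | seq _ _ _ a' _ u' v' hP' hQ' =>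
      obtain ⟨rfl, rfl⟩ := ihP hP'
      obtain ⟨rfl, rfl⟩ := ihQ hQ'
      exact ⟨rfl, rfl⟩
  | ite_true e P Q s s' t he h hP ih =>
    cases h₂ with
    | ite_true _ _ _ _ _ _ _ _ hP' => obtain ⟨rfl, rfl⟩ := ih hP'; exact ⟨rfl, rfl⟩
    | ite_false _ _ _ _ _ _ _ h' _ => exact absurd h' h
  | ite_false e P Q s s' t he h hP ih =>
    cases h₂ with
    | ite_true _ _ _ _ _ _ _ h' _ => exact absurd h h'
    | ite_false _ _ _ _ _ _ _ _ hP' => obtain ⟨rfl, rfl⟩ := ih hP'; exact ⟨rfl, rfl⟩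
  | loop_false e P s he h =>
    cases h₂ with
    | loop_false => exact ⟨rfl, rfl⟩
    | loop_true _ _ _ _ _ _ _ _ h' => exact absurd h h'
  | loop_true e P s a b u v he h hP hL ihP ihL =>
    cases h₂ with
    | loop_false _ _ _ _ h' => exact absurd h' h
    | loop_true _ _ _ a' _ u' v' _ _ hP' hL' =>
      obtain ⟨rfl, rfl⟩ := ihP hP'
      obtain ⟨rfl, rfl⟩ := ihL hL'
      exact ⟨rfl, rfl⟩

/-- On a machine with words of `w` bits, the program `P`, given read-only access to the string `T`
and given `T.length` and the parameter `b` in two registers, halts after exactly `t` time units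
having used no memory cell with address `M` or more, and the sequence of words that it has written
is `out`. The input itself has to consist of words. -/
def Prog.Computes (P : Prog) (w M : ℕ) (T : List ℕ) (b t : ℕ) (out : List ℕ) : Prop :=
  T.length < 2 ^ w ∧ b < 2 ^ w ∧ (∀ a ∈ T, a < 2 ^ w) ∧
    ∃ s : State, Exec w M T P (State.init T.length b) s t ∧ s.out = out

end WordRAM

/-! The program computes, for each end `e` of a factor of `T`, the length `len e` of the longest
factor `T[s..e)` that also occurs at an earlier position. Counting every factor of length `k` at its
first occurrence gives `S_T(k) + (k - 1) = #{1 ≤ e ≤ n | len e < k}` (`substringComplexity_add`), so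
a block of `b` consecutive values of `S_T` can be read off `b` cells of the histogram of `len`, once
the earlier part of the histogram has been summed up. For each of the at most `n / b + 1` blocks all
of the values `len e` are computed again, which has to take time `O(n²)` and constant space.

The start `s` of the longest repeated factor ending at `e` does not decrease with `e`, so two
pointers need only `O(n)` tests of the form "does `x = T[s..e)` occur at an earlier position?". Each
test has to run in time `O(n)` and constant space, which rules out the failure function of Knuth,
Morris and Pratt. Following Rytter, write `x = uv` with `v` the maximal suffix of `x` in the
lexicographic order.

* Every prefix of `v` is a prefix of a power of a word that is larger than all of its proper
  suffixes (`LyndonPower`). The length of that word is the least period of the prefix, and it is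
  updated in constant time when the prefix grows: a letter that continues the period keeps it, a
  smaller letter makes the whole prefix the new period, and a larger letter cannot occur in `v`.
  The same rules find `v`: there, a larger letter refutes the current candidate.
* So `v` can be searched for in the manner of Knuth, Morris and Pratt. If less than two periods
  have been matched, the shift by one period forgets the match, and this is paid for by the shift.
* If `v` occurs at `pos`, no occurrence of `x` has its `v` at one of the next `|u|` positions
  (`IsMaxSuffix.not_match`). So `u` has to be compared only at occurrences of `v` that are more
  than `|u|` apart, in linear time overall.

The rest is a small calculus for the time and the legality of programs (`Run`, `run_loop`). It
represents the registers by a record with named fields, and bounds the number of executions of each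
loop body by a variant. -/

namespace SubstringCount

/-! ### Maximal suffixes and periods -/

/-- The factor of `f` starting at `j` is smaller than the one starting at `i`, and the first
difference is at positions before `N`. (A proper prefix is not counted as smaller.) -/
def LexLt (f : ℕ → ℕ) (N j i : ℕ) : Prop :=
  ∃ t, j + t < N ∧ i + t < N ∧ (∀ r < t, f (j + r) = f (i + r)) ∧ f (j + t) < f (i + t)

theorem LexLt.mono {f : ℕ → ℕ} {N N' j i : ℕ} (h : LexLt f N j i) (hN : N ≤ N') :
    LexLt f N' j i := by
  obtain ⟨t, h1, h2, h3, h4⟩ := h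
  exact ⟨t, by omega, by omega, h3, h4⟩

theorem LexLt.trans {f : ℕ → ℕ} {N i j k : ℕ} (h : LexLt f N i j) (h' : LexLt f N j k) :
    LexLt f N i k := by
  obtain ⟨t, h1, h2, h3, h4⟩ := h
  obtain ⟨t', h1', h2', h3', h4'⟩ := h'
  rcases lt_trichotomy t t' with ht | rfl | ht
  · exact ⟨t, h1, by omega, fun r hr => (h3 r hr).trans (h3' r (hr.trans ht)),
      h3' t ht ▸ h4⟩
  · exact ⟨t, h1, h2', fun r hr => (h3 r hr).trans (h3' r hr), h4.trans h4'⟩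
  · exact ⟨t', by omega, h2', fun r hr => (h3 r (hr.trans ht)).trans (h3' r hr),
      (h3 t' ht).symm ▸ h4'⟩

theorem LexLt.irrefl {f : ℕ → ℕ} {N i : ℕ} : ¬ LexLt f N i i := by
  rintro ⟨t, -, -, -, h⟩
  exact lt_irrefl _ h

/-- The factor of length `h` of `f` at `a` is a prefix of a power of the factor `z` of length `p`
at `a`, and `z` is larger than each of its proper suffixes, none of which is a prefix of `z`
(`z` is a Lyndon word for the reversed order). For `h = 0` the value `p = 1` is allowed. -/
structure LyndonPower (f : ℕ → ℕ) (a h p : ℕ) : Prop where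
  pos : 1 ≤ p
  le : p ≤ max h 1
  period : ∀ r, p + r < h → f (a + (p + r)) = f (a + r)
  maximal : ∀ d, 0 < d → d < p → LexLt f (a + p) (a + d) a

namespace LyndonPower

variable {f : ℕ → ℕ} {a h p : ℕ}

theorem one (f : ℕ → ℕ) (a : ℕ) {h : ℕ} (hh : h ≤ 1) : LyndonPower f a h 1 :=
  ⟨le_rfl, by omega, fun r hr => by omega, fun d h0 h1 => by omega⟩

theorem truncate (hL : LyndonPower f a h p) {h' : ℕ} (h1 : p ≤ h') (h2 : h' ≤ h) :
    LyndonPower f a h' p :=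
  ⟨hL.pos, by omega, fun r hr => hL.period r (by omega), hL.maximal⟩

/-- One period may be dropped at the front if another one remains. -/
theorem dropPeriod (hL : LyndonPower f a h p) (h2 : p + p ≤ h) :
    LyndonPower f (a + p) (h - p) p := by
  refine ⟨hL.pos, by omega, fun r hr => ?_, fun d h0 h1 => ?_⟩
  · rw [add_assoc, add_assoc, hL.period _ (by omega), hL.period _ (by omega)]
  · obtain ⟨t, h3, h4, h5, h6⟩ := hL.maximal d h0 h1
    have key : ∀ r ≤ t, f (a + p + d + r) = f (a + d + r) ∧ f (a + p + r) = f (a + r) := by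
      intro r hr
      have e1 := hL.period (d + r) (by omega)
      have e2 := hL.period r (by omega)
      exact ⟨by simpa only [add_assoc] using e1, by simpa only [add_assoc] using e2⟩
    refine ⟨t, by omega, by omega, fun r hr => ?_, ?_⟩
    · rw [(key r hr.le).1, (key r hr.le).2, h5 r hr]
    · rw [(key t le_rfl).1, (key t le_rfl).2]
      exact h6

theorem succ_of_eq (hL : LyndonPower f a h p) (he : f (a + h) = f (a + (h - p))) :
    LyndonPower f a (h + 1) p := by
  have h1 := hL.pos
  have h2 := hL.le
  refine ⟨h1, by omega, fun r hr => ?_, hL.maximal⟩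
  rcases Nat.lt_succ_iff_lt_or_eq.mp hr with hr | hr
  · exact hL.period r hr
  · rw [hr, he]
    congr 2
    omega

/-- A letter smaller than the one that continues the period closes a new, longer Lyndon word. -/
theorem succ_of_lt (hL : LyndonPower f a h p) (hlt : f (a + h) < f (a + (h - p))) :
    LyndonPower f a (h + 1) (h + 1) := by
  have h1 := hL.pos
  have h2 := hL.le
  have h0 : 0 < h := by
    rcases Nat.eq_zero_or_pos h with rfl | h0
    · simp at hlt
    · exact h0
  refine ⟨by omega, by omega, fun r hr => by omega, fun d => ?_⟩
  induction d using Nat.strong_induction_on with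
  | _ d ih =>
    intro hd0 hd
    rcases lt_trichotomy d p with hdp | rfl | hdp
    · exact (hL.maximal d hd0 hdp).mono (by omega)
    · refine ⟨h - d, by omega, by omega, fun r hr => ?_, ?_⟩
      · rw [add_assoc]; exact hL.period r (by omega)
      · rwa [add_assoc, show d + (h - d) = h by omega]
    · obtain ⟨t, h3, h4, h5, h6⟩ := ih (d - p) (by omega) (by omega) (by omega)
      have key : ∀ r, d + r < h → f (a + d + r) = f (a + (d - p) + r) := by
        intro r hr
        have := hL.period (d - p + r) (by omega)
        rwa [show a + (p + (d - p + r)) = a + d + r by omega, ← add_assoc] at this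
      by_cases ht : d + t < h
      · refine ⟨t, by omega, by omega, fun r hr => ?_, ?_⟩
        · rw [key r (by omega), h5 r hr]
        · rw [key t ht]; exact h6
      · refine ⟨h - d, by omega, by omega, fun r hr => ?_, ?_⟩
        · rw [key r (by omega), h5 r (by omega)]
        · have e1 : a + d + (h - d) = a + h := by omega
          have e2 : a + (h - p) = a + (d - p) + (h - d) := by omega
          rw [e1]
          rw [e2] at hlt
          rcases Nat.lt_or_ge (h - d) t with ht' | ht'
          · rwa [← h5 _ ht']
          · have : h - d = t := by omega
            rw [this] at hlt ⊢
            exact hlt.trans h6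

/-- A letter larger than the one that continues the period makes the suffix after the first period
larger than every suffix that starts earlier. -/
theorem lexLt_of_lt (hL : LyndonPower f a h p) (h0 : 0 < h)
    (hlt : f (a + (h - p)) < f (a + h)) {j : ℕ} (h1 : a ≤ j) (h2 : j < a + p) :
    LexLt f (a + h + 1) j (a + p) := by
  have h3 := hL.pos
  have h4 := hL.le
  have key : LexLt f (a + h + 1) a (a + p) := by
    refine ⟨h - p, by omega, by omega, fun r hr => ?_, ?_⟩
    · rw [add_assoc]; exact (hL.period r (by omega)).symm
    · rwa [add_assoc, show p + (h - p) = h by omega]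
  rcases Nat.eq_or_lt_of_le h1 with rfl | h1
  · exact key
  · have := hL.maximal (j - a) (by omega) (by omega)
    rw [show a + (j - a) = j by omega] at this
    exact (this.mono (by omega)).trans key

theorem not_lexLt (hL : LyndonPower f a h p) (d : ℕ) : ¬ LexLt f (a + h) a (a + d) := by
  induction d using Nat.strong_induction_on with
  | _ d ih =>
    have hp := hL.pos
    have hp' := hL.le
    rcases Nat.eq_zero_or_pos d with rfl | hd0
    · exact LexLt.irrefl
    intro hlt
    rcases Nat.lt_or_ge d p with hd | hd
    · obtain ⟨t, h1, h2, -, -⟩ := id hlt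
      exact LexLt.irrefl (hlt.trans ((hL.maximal d hd0 hd).mono (by omega)))
    · obtain ⟨t, h1, h2, h3, h4⟩ := hlt
      have key : ∀ r ≤ t, f (a + d + r) = f (a + (d - p) + r) := by
        intro r hr
        have := hL.period (d - p + r) (by omega)
        rwa [show a + (p + (d - p + r)) = a + d + r by omega, ← add_assoc] at this
      refine ih (d - p) (by omega) ⟨t, h1, by omega, fun r hr => ?_, ?_⟩
      · rw [h3 r hr, key r hr.le]
      · rw [← key t le_rfl]; exact h4

/-- If the factor of length `h` at `a` also occurs at `pos`, no longer factor that starts at `a`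
can occur less than a period after `pos`. -/
theorem exists_ne (hL : LyndonPower f a h p) {pos : ℕ}
    (hm : ∀ r < h, f (pos + r) = f (a + r)) {d : ℕ} (hd0 : 0 < d) (hd : d < p) :
    ∃ t < h, f (pos + d + t) ≠ f (a + t) := by
  have hp' := hL.le
  obtain ⟨t, h1, h2, -, h4⟩ := hL.maximal d hd0 hd
  refine ⟨t, by omega, ?_⟩
  rw [add_assoc, hm (d + t) (by omega), ← add_assoc]
  exact h4.ne

end LyndonPower

/-- The factor of `f` between `a` and `e` is the maximal suffix of the factor between `s`
and `e`. -/
structure IsMaxSuffix (f : ℕ → ℕ) (s e a : ℕ) : Prop where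
  le : s ≤ a
  lt : a < e
  before : ∀ j, s ≤ j → j < a → LexLt f e j a
  after : ∀ d, ¬ LexLt f e a (a + d)

/-- In the maximal suffix, the letter that follows a prefix never exceeds the one that would
continue the period of that prefix. -/
theorem IsMaxSuffix.le_of_lyndonPower {f : ℕ → ℕ} {s e a h p : ℕ} (hM : IsMaxSuffix f s e a)
    (hL : LyndonPower f a h p) (hh : a + h < e) : f (a + h) ≤ f (a + (h - p)) := by
  rcases Nat.eq_zero_or_pos h with rfl | h0
  · simp
  · by_contra! hlt
    exact hM.after p ((hL.lexLt_of_lt h0 hlt le_rfl (by have := hL.pos; omega)).mono (by omega))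

/-- Let `v` be the maximal suffix of a word `x = uv`. If `v` occurs at `pos`, then no occurrence of
`x` has its suffix `v` at one of the next `|u|` positions. -/
theorem IsMaxSuffix.not_match {f : ℕ → ℕ} {s e a pos j : ℕ} (hM : IsMaxSuffix f s e a)
    (hv : ∀ r, a + r < e → f (pos + r) = f (a + r)) (h1 : pos + s < j + a) (h2 : j ≤ pos) :
    ¬ ∀ r, s + r < e → f (j + r) = f (s + r) := by
  intro hx
  have h3 := hM.le
  obtain ⟨t, h4, h5, -, h6⟩ := hM.before (s + (pos - j)) (by omega) (by omega)
  have e1 := hx (pos - j + t) (by omega)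
  have e2 := hv t h5
  rw [show j + (pos - j + t) = pos + t by omega, e2, ← add_assoc] at e1
  omega

/-! ### Counting factors by the longest suffixes that occur before -/

/-- The factor of `f` between `s` and `e` has an earlier occurrence. -/
def Repeats (f : ℕ → ℕ) (s e : ℕ) : Prop :=
  ∃ j < s, ∀ r, s + r < e → f (j + r) = f (s + r)

theorem Repeats.start_mono {f : ℕ → ℕ} {s s' e : ℕ} (h : Repeats f s e) (hs : s ≤ s') :
    Repeats f s' e := by
  obtain ⟨j, hj, h⟩ := h
  refine ⟨j + (s' - s), by omega, fun r hr => ?_⟩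
  have := h (s' - s + r) (by omega)
  rwa [← add_assoc, show s + (s' - s + r) = s' + r by omega] at this

theorem Repeats.end_anti {f : ℕ → ℕ} {s e e' : ℕ} (h : Repeats f s e) (he : e' ≤ e) :
    Repeats f s e' := by
  obtain ⟨j, hj, h⟩ := h
  exact ⟨j, hj, fun r hr => h r (by omega)⟩

open Classical in
/-- The length of the longest factor that ends at `e` and has an earlier occurrence: such factors
are closed under taking suffixes, so it is enough to count their starting points. -/
noncomputable def repLength (f : ℕ → ℕ) (e : ℕ) : ℕ :=
  ((Finset.range e).filter fun i => Repeats f i e).card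

theorem repLength_le (f : ℕ → ℕ) (e : ℕ) : repLength f e ≤ e := by
  classical
  exact (Finset.card_filter_le _ _).trans (by simp)

theorem repLength_eq {f : ℕ → ℕ} {s e : ℕ} (h1 : ∀ i < s, ¬ Repeats f i e)
    (h2 : s < e → Repeats f s e) : repLength f e = e - s := by
  classical
  have : ((Finset.range e).filter fun i => Repeats f i e) = Finset.Ico s e := by
    ext i
    simp only [Finset.mem_filter, Finset.mem_range, Finset.mem_Ico]
    constructor
    · rintro ⟨hi, hr⟩
      exact ⟨by by_contra! h; exact h1 i h hr, hi⟩
    · rintro ⟨hs, hi⟩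
      exact ⟨hi, (h2 (by omega)).start_mono hs⟩
  rw [repLength, this, Nat.card_Ico]

theorem repLength_lt_iff {f : ℕ → ℕ} {i k : ℕ} (hk : 1 ≤ k) :
    repLength f (i + k) < k ↔ ¬ Repeats f i (i + k) := by
  classical
  constructor
  · intro h hr
    have : Finset.Ico i (i + k) ⊆ (Finset.range (i + k)).filter fun j => Repeats f j (i + k) := by
      intro j hj
      simp only [Finset.mem_filter, Finset.mem_range, Finset.mem_Ico] at hj ⊢
      exact ⟨hj.2, hr.start_mono hj.1⟩
    have := Finset.card_le_card this
    rw [Nat.card_Ico] at this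
    rw [repLength] at h
    omega
  · intro hr
    have : ((Finset.range (i + k)).filter fun j => Repeats f j (i + k)) ⊆
        Finset.Ico (i + 1) (i + k) := by
      intro j hj
      simp only [Finset.mem_filter, Finset.mem_range, Finset.mem_Ico] at hj ⊢
      refine ⟨?_, hj.1⟩
      by_contra! h
      exact hr (hj.2.start_mono (by omega))
    have := Finset.card_le_card this
    rw [Nat.card_Ico] at this
    rw [repLength]
    omega

/-- The number of ends `1 ≤ e < m` with `repLength f e = l`. -/
noncomputable def repCount (f : ℕ → ℕ) (m l : ℕ) : ℕ :=
  ((Finset.Ico 1 m).filter fun e => repLength f e = l).card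

theorem repCount_one (f : ℕ → ℕ) (l : ℕ) : repCount f 1 l = 0 := by
  simp [repCount]

theorem repCount_succ (f : ℕ → ℕ) {m : ℕ} (hm : 1 ≤ m) (l : ℕ) :
    repCount f (m + 1) l = repCount f m l + if repLength f m = l then 1 else 0 := by
  have : Finset.Ico 1 (m + 1) = insert m (Finset.Ico 1 m) := by
    ext; simp; omega
  rw [repCount, repCount, this, Finset.filter_insert]
  split_ifs with h
  · rw [Finset.card_insert_of_notMem (by simp)]
  · rfl

theorem repCount_le (f : ℕ → ℕ) (m l : ℕ) : repCount f m l ≤ m - 1 := by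
  exact (Finset.card_filter_le _ _).trans (by simp)

/-- The number of ends `1 ≤ e < m` with `repLength f e < l`. -/
noncomputable def repCountLt (f : ℕ → ℕ) (m l : ℕ) : ℕ :=
  ((Finset.Ico 1 m).filter fun e => repLength f e < l).card

theorem repCountLt_zero (f : ℕ → ℕ) (m : ℕ) : repCountLt f m 0 = 0 := by
  simp [repCountLt]

theorem repCountLt_succ (f : ℕ → ℕ) (m l : ℕ) :
    repCountLt f m (l + 1) = repCountLt f m l + repCount f m l := by
  rw [repCountLt, repCountLt, repCount, ← Finset.card_union_of_disjoint]
  · congr 1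
    ext e
    simp only [Finset.mem_filter, Finset.mem_union]
    have : repLength f e < l + 1 ↔ repLength f e < l ∨ repLength f e = l := by omega
    tauto
  · rw [Finset.disjoint_filter]
    intro e _ h1 h2
    omega

theorem repCountLt_le (f : ℕ → ℕ) (m l : ℕ) : repCountLt f m l ≤ m - 1 := by
  exact (Finset.card_filter_le _ _).trans (by simp)

theorem take_drop_eq_iff {T : List ℕ} {i j k : ℕ} (hi : i + k ≤ T.length)
    (hj : j + k ≤ T.length) :
    (T.drop i).take k = (T.drop j).take k ↔
      ∀ r < k, T.getD (i + r) 0 = T.getD (j + r) 0 := by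
  constructor
  · intro h r hr
    have := congrArg (fun L : List ℕ => L[r]?) h
    simp only [List.getElem?_take, hr, if_true, List.getElem?_drop] at this
    simp [List.getD_eq_getElem?_getD, this]
  · intro h
    apply List.ext_getElem
    · simp; omega
    · intro r h1 h2
      simp only [List.length_take, List.length_drop] at h1
      have := h r (by omega)
      rw [List.getD_eq_getElem _ _ (by omega), List.getD_eq_getElem _ _ (by omega)] at this
      simpa using this

/-- Each factor of length `k` is counted at its first occurrence. -/
theorem substringComplexity_eq_card_first (T : List ℕ) {k : ℕ} (hk : k ≤ T.length) :
    open Classical in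
    substringComplexity T k = ((Finset.range (T.length + 1 - k)).filter
      fun i => ¬ Repeats (fun i => T.getD i 0) i (i + k)).card := by
  classical
  have hset : {u : List ℕ | u.length = k ∧ u <:+: T} =
      ((((Finset.range (T.length + 1 - k)).filter
        fun i => ¬ Repeats (fun i => T.getD i 0) i (i + k)).image
          fun i => (T.drop i).take k : Finset (List ℕ)) : Set (List ℕ)) := by
    ext u
    simp only [Set.mem_ofPred_eq, Finset.coe_image, Set.mem_image, Finset.coe_filter,
      Finset.mem_range]
    constructor
    · rintro ⟨hu, x, y, hT⟩
      have hex : ∃ i, i + k ≤ T.length ∧ (T.drop i).take k = u := by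
        refine ⟨x.length, ?_, ?_⟩
        · rw [← hT, ← hu]; simp
        · rw [← hT, ← hu]; simp
      obtain ⟨h1, h2⟩ := Nat.find_spec hex
      refine ⟨Nat.find hex, ⟨by omega, ?_⟩, h2⟩
      rintro ⟨j, hj, h⟩
      refine Nat.find_min hex hj ⟨by omega, ?_⟩
      rw [← h2, take_drop_eq_iff (by omega) h1]
      exact fun r hr => h r (by omega)
    · rintro ⟨i, ⟨hi, -⟩, rfl⟩
      refine ⟨by simp; omega, ?_⟩
      exact (List.take_prefix _ _).isInfix.trans (List.drop_suffix _ _).isInfix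
  rw [substringComplexity, hset, Set.ncard_coe_finset, Finset.card_image_of_injOn]
  have key : ∀ i j, i < j → j + k ≤ T.length → (T.drop i).take k = (T.drop j).take k →
      Repeats (fun i => T.getD i 0) j (j + k) := by
    intro i j hij hj h
    rw [take_drop_eq_iff (by omega) hj] at h
    exact ⟨i, hij, fun r hr => h r (by omega)⟩
  intro i hi j hj hij
  simp only [Finset.coe_filter, Finset.mem_range, Set.mem_ofPred_eq] at hi hj
  rcases lt_trichotomy i j with h | h | h
  · exact absurd (key i j h (by omega) hij) hj.2
  · exact h
  · exact absurd (key j i h (by omega) hij.symm) hi.2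

/-- The ends `e < k` are too small to be ends of a factor of length `k`, hence the correction. -/
theorem substringComplexity_add (T : List ℕ) {k : ℕ} (hk : k < T.length) :
    substringComplexity T (k + 1) + k =
      repCountLt (fun i => T.getD i 0) (T.length + 1) (k + 1) := by
  classical
  set f : ℕ → ℕ := fun i => T.getD i 0
  rw [substringComplexity_eq_card_first T hk, repCountLt,
    ← Finset.card_map (addRightEmbedding (k + 1))]
  calc _ = _ + (Finset.Ico 1 (k + 1)).card := by rw [Nat.card_Ico, Nat.add_sub_cancel]
    _ = _ := ?_
  rw [← Finset.card_union_of_disjoint]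
  · congr 1
    ext e
    simp only [Finset.mem_union, Finset.mem_map, Finset.mem_filter, Finset.mem_range,
      addRightEmbedding_apply, Finset.mem_Ico]
    constructor
    · rintro (⟨i, ⟨h1, h2⟩, rfl⟩ | h)
      · exact ⟨by omega, (repLength_lt_iff (by omega)).2 h2⟩
      · exact ⟨by omega, (repLength_le f e).trans_lt h.2⟩
    · rintro ⟨h1, h2⟩
      rcases Nat.lt_or_ge e (k + 1) with h | h
      · exact Or.inr ⟨h1.1, h⟩
      · refine Or.inl ⟨e - (k + 1), ⟨by omega, ?_⟩, by omega⟩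
        rw [← repLength_lt_iff (by omega), Nat.sub_add_cancel h]
        exact h2
  · rw [Finset.disjoint_left]
    simp only [Finset.mem_map, Finset.mem_filter, Finset.mem_range,
      addRightEmbedding_apply, Finset.mem_Ico]
    rintro e ⟨i, -, rfl⟩ h
    omega

theorem substringComplexity_eq_zero {T : List ℕ} {k : ℕ} (hk : T.length < k) :
    substringComplexity T k = 0 := by
  have : {u : List ℕ | u.length = k ∧ u <:+: T} = ∅ := by
    ext u
    simp only [Set.mem_ofPred_eq, Set.mem_empty_iff_false, iff_false, not_and]
    intro hu h
    have := h.length_le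
    omega
  rw [substringComplexity, this, Set.ncard_empty]

/-- A fraction that equals one of the ratios `S_T(k) / k` and is at least as large as those with
`k ≤ n` is `δ`. -/
theorem delta_eq_div {T : List ℕ} {p q : ℕ} (hq : 1 ≤ q) (hp : p = substringComplexity T q)
    (hmax : ∀ k, 1 ≤ k → k ≤ T.length → substringComplexity T k * q ≤ p * k) :
    delta T = (p : ℝ) / q := by
  refine le_antisymm ((isLUB_delta T).2 ?_) ((isLUB_delta T).1 ⟨q, hq, by rw [hp]⟩)
  rintro x ⟨k, hk, rfl⟩
  rcases Nat.lt_or_ge T.length k with h | h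
  · rw [substringComplexity_eq_zero h]
    simp only [Nat.cast_zero, zero_div]
    positivity
  · rw [div_le_div_iff₀ (by exact_mod_cast hk) (by exact_mod_cast hq)]
    exact_mod_cast hmax k hk h

end SubstringCount

namespace WordRAM

/-! ### Reasoning about executions -/

/-! Constants and arithmetic operations stand for the expressions that compute them. -/

instance : Zero Expr := ⟨.const 0⟩
instance : One Expr := ⟨.const 1⟩
instance : Add Expr := ⟨.op .add⟩
instance : Sub Expr := ⟨.op .sub⟩
instance : Mul Expr := ⟨.op .mul⟩

/-- The comparison `e₁ < e₂`. -/
def Expr.lt (e₁ e₂ : Expr) : Expr := .op .lt e₁ e₂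

/-- The comparison `e₁ = e₂`. -/
def Expr.eq (e₁ e₂ : Expr) : Expr := .op .eq e₁ e₂

/-- The input letters, continued by `0` beyond the end of the input. -/
def letter (T : List ℕ) (i : ℕ) : ℕ := T.getD i 0

section Expr

variable {w M : ℕ} {T : List ℕ} {s : State} {e e₁ e₂ : Expr}

@[simp] theorem val_zero : (0 : Expr).val T s = 0 := rfl
@[simp] theorem val_one : (1 : Expr).val T s = 1 := rfl
@[simp] theorem val_reg {r : ℕ} : (Expr.reg r).val T s = s.reg r := rfl
@[simp] theorem val_mem : (Expr.mem e).val T s = s.mem (e.val T s) := rfl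
@[simp] theorem val_input : (Expr.input e).val T s = letter T (e.val T s) := rfl
@[simp] theorem val_add : (e₁ + e₂).val T s = e₁.val T s + e₂.val T s := rfl
@[simp] theorem val_sub : (e₁ - e₂).val T s = e₁.val T s - e₂.val T s := rfl
@[simp] theorem val_mul : (e₁ * e₂).val T s = e₁.val T s * e₂.val T s := rfl

theorem val_lt_le : (e₁.lt e₂).val T s ≤ 1 := by
  change (if e₁.val T s < e₂.val T s then 1 else 0) ≤ 1
  split_ifs <;> simp

theorem val_eq_le : (e₁.eq e₂).val T s ≤ 1 := by
  change (if e₁.val T s = e₂.val T s then 1 else 0) ≤ 1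
  split_ifs <;> simp

@[simp] theorem val_lt_eq_zero : (e₁.lt e₂).val T s = 0 ↔ e₂.val T s ≤ e₁.val T s := by
  change (if e₁.val T s < e₂.val T s then 1 else 0) = 0 ↔ _
  split_ifs with h
  · simpa using h
  · simpa using h

@[simp] theorem val_eq_eq_zero : (e₁.eq e₂).val T s = 0 ↔ e₁.val T s ≠ e₂.val T s := by
  change (if e₁.val T s = e₂.val T s then 1 else 0) = 0 ↔ _
  split_ifs with h
  · simpa using h
  · simpa using h

@[simp] theorem legal_zero : (0 : Expr).Legal w M T s := Nat.two_pow_pos w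
@[simp] theorem legal_reg {r : ℕ} : (Expr.reg r).Legal w M T s := trivial
@[simp] theorem legal_mem :
    (Expr.mem e).Legal w M T s ↔ e.Legal w M T s ∧ e.val T s < M := Iff.rfl
@[simp] theorem legal_input :
    (Expr.input e).Legal w M T s ↔ e.Legal w M T s ∧ e.val T s < T.length := Iff.rfl
@[simp] theorem legal_add : (e₁ + e₂).Legal w M T s ↔
    e₁.Legal w M T s ∧ e₂.Legal w M T s ∧ e₁.val T s + e₂.val T s < 2 ^ w := Iff.rfl
@[simp] theorem legal_sub : (e₁ - e₂).Legal w M T s ↔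
    e₁.Legal w M T s ∧ e₂.Legal w M T s ∧ e₁.val T s - e₂.val T s < 2 ^ w := Iff.rfl
@[simp] theorem legal_mul : (e₁ * e₂).Legal w M T s ↔
    e₁.Legal w M T s ∧ e₂.Legal w M T s ∧ e₁.val T s * e₂.val T s < 2 ^ w := Iff.rfl

theorem legal_one (hw : 0 < w) : (1 : Expr).Legal w M T s := Nat.one_lt_two_pow hw.ne'

theorem legal_lt (hw : 0 < w) :
    (e₁.lt e₂).Legal w M T s ↔ e₁.Legal w M T s ∧ e₂.Legal w M T s :=
  ⟨fun h => ⟨h.1, h.2.1⟩, fun h => ⟨h.1, h.2, val_lt_le.trans_lt (Nat.one_lt_two_pow hw.ne')⟩⟩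

theorem legal_eq (hw : 0 < w) :
    (e₁.eq e₂).Legal w M T s ↔ e₁.Legal w M T s ∧ e₂.Legal w M T s :=
  ⟨fun h => ⟨h.1, h.2.1⟩, fun h => ⟨h.1, h.2, val_eq_le.trans_lt (Nat.one_lt_two_pow hw.ne')⟩⟩

theorem legal_mul_of_le_one (hw : 0 < w) (h₁ : e₁.Legal w M T s) (h₂ : e₂.Legal w M T s)
    (hv₁ : e₁.val T s ≤ 1) (hv₂ : e₂.val T s ≤ 1) : (e₁ * e₂).Legal w M T s :=
  ⟨h₁, h₂, (Nat.mul_le_mul hv₁ hv₂).trans_lt (Nat.one_lt_two_pow hw.ne')⟩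

@[simp] theorem size_zero : (0 : Expr).size = 1 := rfl
@[simp] theorem size_one : (1 : Expr).size = 1 := rfl
@[simp] theorem size_reg {r : ℕ} : (Expr.reg r).size = 1 := rfl
@[simp] theorem size_mem : (Expr.mem e).size = e.size + 1 := rfl
@[simp] theorem size_input : (Expr.input e).size = e.size + 1 := rfl
@[simp] theorem size_add : (e₁ + e₂).size = e₁.size + e₂.size + 1 := rfl
@[simp] theorem size_sub : (e₁ - e₂).size = e₁.size + e₂.size + 1 := rfl
@[simp] theorem size_mul : (e₁ * e₂).size = e₁.size + e₂.size + 1 := rfl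
@[simp] theorem size_lt : (e₁.lt e₂).size = e₁.size + e₂.size + 1 := rfl
@[simp] theorem size_eq : (e₁.eq e₂).size = e₁.size + e₂.size + 1 := rfl

end Expr

/-- Total correctness with time: `P` started in `s` halts legally after some time `t` in a state
`s'` such that `Q s' t`. -/
def Run (w M : ℕ) (T : List ℕ) (P : Prog) (s : State) (Q : State → ℕ → Prop) : Prop :=
  ∃ s' t, Exec w M T P s s' t ∧ Q s' t

section Run

variable {w M : ℕ} {T : List ℕ} {s : State} {Q : State → ℕ → Prop}

theorem Run.mono {P : Prog} {Q' : State → ℕ → Prop} (h : Run w M T P s Q)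
    (hQ : ∀ s' t, Q s' t → Q' s' t) : Run w M T P s Q' := by
  obtain ⟨s', t, he, h⟩ := h
  exact ⟨s', t, he, hQ _ _ h⟩

theorem run_skip (h : Q s 1) : Run w M T .skip s Q := ⟨_, _, .skip s, h⟩

theorem run_assign {r : ℕ} {e : Expr} (he : e.Legal w M T s)
    (h : Q { s with reg := Function.update s.reg r (e.val T s) } (e.size + 1)) :
    Run w M T (.assign r e) s Q := ⟨_, _, .assign r e s he, h⟩

theorem run_store {a e : Expr} (ha : a.Legal w M T s) (haM : a.val T s < M)
    (he : e.Legal w M T s)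
    (h : Q { s with mem := Function.update s.mem (a.val T s) (e.val T s) }
      (a.size + e.size + 1)) :
    Run w M T (.store a e) s Q := ⟨_, _, .store a e s ha haM he, h⟩

theorem run_output {e : Expr} (he : e.Legal w M T s)
    (h : Q { s with out := s.out ++ [e.val T s] } (e.size + 1)) :
    Run w M T (.output e) s Q := ⟨_, _, .output e s he, h⟩

theorem run_seq {P R : Prog}
    (h : Run w M T P s fun s₁ t₁ => Run w M T R s₁ fun s₂ t₂ => Q s₂ (t₁ + t₂)) :
    Run w M T (.seq P R) s Q := by
  obtain ⟨s₁, t₁, h₁, s₂, t₂, h₂, h⟩ := h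
  exact ⟨s₂, _, .seq _ _ _ _ _ _ _ h₁ h₂, h⟩

theorem run_ite {e : Expr} {P R : Prog} (he : e.Legal w M T s)
    (h₁ : e.val T s ≠ 0 → Run w M T P s fun s' t => Q s' (e.size + 1 + t))
    (h₂ : e.val T s = 0 → Run w M T R s fun s' t => Q s' (e.size + 1 + t)) :
    Run w M T (.ite e P R) s Q := by
  by_cases h : e.val T s = 0
  · obtain ⟨s', t, hx, hq⟩ := h₂ h
    exact ⟨s', _, .ite_false _ _ _ _ _ _ he h hx, hq⟩
  · obtain ⟨s', t, hx, hq⟩ := h₁ h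
    exact ⟨s', _, .ite_true _ _ _ _ _ _ he h hx, hq⟩

/-- A loop with invariant `I`, variant `μ`, and at most `c` time units for each execution of its
body. The states that occur are parametrized by `g : α → State`. -/
theorem run_loop {α : Type*} (g : α → State) (I : α → Prop) (μ : α → ℕ) (c : ℕ) {e : Expr}
    {P : Prog} (hleg : ∀ x, I x → e.Legal w M T (g x))
    (hbody : ∀ x, I x → e.val T (g x) ≠ 0 →
      Run w M T P (g x) fun s' t => ∃ y, s' = g y ∧ I y ∧ μ y < μ x ∧ t ≤ c)
    (x : α) (hx : I x) :
    Run w M T (.loop e P) (g x) fun s' t =>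
      ∃ y, s' = g y ∧ I y ∧ e.val T (g y) = 0 ∧ t ≤ (μ x + 1) * (e.size + 1 + c) := by
  induction hm : μ x using Nat.strong_induction_on generalizing x with
  | _ m ih =>
    subst hm
    by_cases h : e.val T (g x) = 0
    · refine ⟨g x, _, .loop_false _ _ _ (hleg x hx) h, x, rfl, hx, h, ?_⟩
      nlinarith
    · obtain ⟨_, t₁, h₁, y, rfl, hy, hlt, ht₁⟩ := hbody x hx h
      obtain ⟨_, t₂, h₂, z, rfl, hz, hz0, ht₂⟩ := ih _ hlt y hy rfl
      refine ⟨_, _, .loop_true _ _ _ _ _ _ _ (hleg x hx) h h₁ h₂, z, rfl, hz, hz0, ?_⟩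
      calc e.size + 1 + t₁ + t₂ ≤ (e.size + 1 + c) + (μ y + 1) * (e.size + 1 + c) := by omega
        _ = (μ y + 1 + 1) * (e.size + 1 + c) := by ring
        _ ≤ _ := Nat.mul_le_mul_right _ (by omega)

end Run

/-! ### Named registers -/

/-- The values of the registers `0, …, 15`:
* `n`, `b`: the input parameters;
* `k`, `acc`: the number of values written in the completed blocks, and the sum of the histogram
  entries read so far;
* `num`, `den`: the best ratio so far;
* `s`, `e`: the current window of the input;
* `a`, `h`, `p`: the candidate for the maximal suffix, the length of the part inspected so far,
  and its period;
* `pos`: the current position in the search for the maximal suffix;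
* `ok`: the first position at which the whole window is worth comparing;
* `m`: the number of letters matched before the maximal suffix;
* `found`: whether the window has been found;
* `r`: an index into the memory. -/
structure Vars where
  (n b k acc num den s e a h p pos ok m found r : ℕ)

/-- The register contents described by `v`. -/
def Vars.reg (v : Vars) : ℕ → ℕ
  | 0 => v.n | 1 => v.b | 2 => v.k | 3 => v.acc | 4 => v.num | 5 => v.den | 6 => v.s | 7 => v.e
  | 8 => v.a | 9 => v.h | 10 => v.p | 11 => v.pos | 12 => v.ok | 13 => v.m | 14 => v.found
  | 15 => v.r | _ => 0

/-- The state with the registers given by `v`, memory `mem` and output `out`. -/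
def Vars.state (v : Vars) (mem : ℕ → ℕ) (out : List ℕ) : State := ⟨v.reg, mem, out⟩

/-- The result of storing `x` in register `i`. -/
def Vars.set (v : Vars) (i x : ℕ) : Vars :=
  match i with
  | 0 => { v with n := x } | 1 => { v with b := x } | 2 => { v with k := x }
  | 3 => { v with acc := x } | 4 => { v with num := x } | 5 => { v with den := x }
  | 6 => { v with s := x } | 7 => { v with e := x } | 8 => { v with a := x }
  | 9 => { v with h := x } | 10 => { v with p := x } | 11 => { v with pos := x }
  | 12 => { v with ok := x } | 13 => { v with m := x } | 14 => { v with found := x }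
  | 15 => { v with r := x } | _ => v

theorem Vars.reg_set (v : Vars) {i : ℕ} (hi : i < 16) (x : ℕ) :
    (v.set i x).reg = Function.update v.reg i x := by
  funext r
  by_cases hr : r = i
  · subst hr
    rw [Function.update_self]
    interval_cases r <;> rfl
  · rw [Function.update_of_ne hr]
    by_cases hr' : r < 16
    · interval_cases i <;> interval_cases r <;> first | rfl | exact absurd rfl hr
    · obtain ⟨r, rfl⟩ := Nat.exists_eq_add_of_le' (not_lt.mp hr')
      rfl

section Registers

variable {w M : ℕ} {T : List ℕ} {v : Vars} {mem : ℕ → ℕ} {out : List ℕ} {Q : State → ℕ → Prop}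

@[simp] theorem state_mem : (v.state mem out).mem = mem := rfl
@[simp] theorem state_out : (v.state mem out).out = out := rfl
@[simp] theorem state_reg_n : (v.state mem out).reg 0 = v.n := rfl
@[simp] theorem state_reg_b : (v.state mem out).reg 1 = v.b := rfl
@[simp] theorem state_reg_k : (v.state mem out).reg 2 = v.k := rfl
@[simp] theorem state_reg_acc : (v.state mem out).reg 3 = v.acc := rfl
@[simp] theorem state_reg_num : (v.state mem out).reg 4 = v.num := rfl
@[simp] theorem state_reg_den : (v.state mem out).reg 5 = v.den := rfl
@[simp] theorem state_reg_s : (v.state mem out).reg 6 = v.s := rfl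
@[simp] theorem state_reg_e : (v.state mem out).reg 7 = v.e := rfl
@[simp] theorem state_reg_a : (v.state mem out).reg 8 = v.a := rfl
@[simp] theorem state_reg_h : (v.state mem out).reg 9 = v.h := rfl
@[simp] theorem state_reg_p : (v.state mem out).reg 10 = v.p := rfl
@[simp] theorem state_reg_pos : (v.state mem out).reg 11 = v.pos := rfl
@[simp] theorem state_reg_ok : (v.state mem out).reg 12 = v.ok := rfl
@[simp] theorem state_reg_m : (v.state mem out).reg 13 = v.m := rfl
@[simp] theorem state_reg_found : (v.state mem out).reg 14 = v.found := rfl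
@[simp] theorem state_reg_r : (v.state mem out).reg 15 = v.r := rfl

theorem run_set {i : ℕ} {e : Expr} (hi : i < 16) (he : e.Legal w M T (v.state mem out))
    (h : Q ((v.set i (e.val T (v.state mem out))).state mem out) (e.size + 1)) :
    Run w M T (.assign i e) (v.state mem out) Q := by
  refine run_assign he ?_
  rw [Vars.state, v.reg_set hi] at h
  exact h

theorem run_put {a e : Expr} (ha : a.Legal w M T (v.state mem out))
    (haM : a.val T (v.state mem out) < M) (he : e.Legal w M T (v.state mem out))
    (h : Q (v.state (Function.update mem (a.val T (v.state mem out))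
      (e.val T (v.state mem out))) out) (a.size + e.size + 1)) :
    Run w M T (.store a e) (v.state mem out) Q := run_store ha haM he h

theorem run_write {e : Expr} (he : e.Legal w M T (v.state mem out))
    (h : Q (v.state mem (out ++ [e.val T (v.state mem out)])) (e.size + 1)) :
    Run w M T (.output e) (v.state mem out) Q := run_output he h

end Registers

/-! ### The program -/

namespace SubstringProg

/-- One step of the computation of the maximal suffix. -/
def maxSuffixStep : Prog :=
  .ite ((Expr.input (.reg 8 + .reg 9)).eq (.input (.reg 8 + (.reg 9 - .reg 10))))
    (.assign 9 (.reg 9 + 1))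
    (.ite ((Expr.input (.reg 8 + .reg 9)).lt (.input (.reg 8 + (.reg 9 - .reg 10))))
      (.seq (.assign 9 (.reg 9 + 1)) (.assign 10 (.reg 9)))
      (.seq (.assign 8 (.reg 8 + .reg 10))
        (.ite ((Expr.reg 9).lt (.reg 10 + .reg 10))
          (.seq (.assign 9 1) (.assign 10 1))
          (.assign 9 (.reg 9 - .reg 10)))))

/-- Computes the start `a` of the maximal suffix of the window. -/
def maxSuffix : Prog :=
  .seq (.assign 8 (.reg 6)) <| .seq (.assign 9 1) <| .seq (.assign 10 1) <|
    .loop ((Expr.reg 8 + .reg 9).lt (.reg 7)) maxSuffixStep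

/-- Moves on to the next position at which the maximal suffix may occur. -/
def shift : Prog :=
  .seq (.assign 11 (.reg 11 + .reg 10)) <|
    .ite ((Expr.reg 9).lt (.reg 10 + .reg 10))
      (.seq (.assign 9 0) (.assign 10 1))
      (.assign 9 (.reg 9 - .reg 10))

/-- One step of the search for the window. -/
def searchStep : Prog :=
  .ite ((Expr.reg 8 + .reg 9).lt (.reg 7))
    (.ite ((Expr.input (.reg 11 + .reg 9)).eq (.input (.reg 8 + .reg 9)))
      (.ite ((Expr.input (.reg 8 + .reg 9)).eq (.input (.reg 8 + (.reg 9 - .reg 10))))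
        (.assign 9 (.reg 9 + 1))
        (.seq (.assign 9 (.reg 9 + 1)) (.assign 10 (.reg 9))))
      shift)
    (.ite ((Expr.reg 11).lt (.reg 12))
      shift
      (.ite ((Expr.reg 6 + .reg 13).lt (.reg 8))
        (.ite ((Expr.input (.reg 11 - (.reg 8 - .reg 6) + .reg 13)).eq
            (.input (.reg 6 + .reg 13)))
          (.assign 13 (.reg 13 + 1))
          (.seq (.assign 12 (.reg 11 + (.reg 8 - .reg 6) + 1)) (.assign 13 0)))
        (.assign 14 1)))

/-- Searches the window `u v`, with maximal suffix `v`, at earlier positions. -/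
def search : Prog :=
  .seq (.assign 9 0) <| .seq (.assign 10 1) <| .seq (.assign 11 (.reg 8 - .reg 6)) <|
    .seq (.assign 12 (.reg 8 - .reg 6)) <| .seq (.assign 13 0) <| .seq (.assign 14 0) <|
      .loop ((Expr.reg 11).lt (.reg 8) * (Expr.reg 14).eq 0) searchStep

/-- Counts the current repeat length, if it belongs to the current block. -/
def record : Prog :=
  .ite ((Expr.reg 7 - .reg 6).lt (.reg 2)) .skip
    (.ite ((Expr.reg 7 - .reg 6).lt (.reg 2 + .reg 1))
      (.store (.reg 7 - .reg 6 - .reg 2) (.mem (.reg 7 - .reg 6 - .reg 2) + 1))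
      .skip)

/-- Shrinks the window if it has no earlier occurrence, and extends it otherwise. -/
def windowStep : Prog :=
  .seq (.assign 14 1) <|
    .seq (.ite ((Expr.reg 6).lt (.reg 7)) (.seq maxSuffix search) .skip) <|
      .ite (.reg 14) (.seq record (.assign 7 (.reg 7 + 1))) (.assign 6 (.reg 6 + 1))

/-- Computes the histogram of the repeat lengths in the current block. -/
def histogram : Prog :=
  .seq (.assign 6 0) <| .seq (.assign 7 1) <|
    .loop ((Expr.reg 7).lt (.reg 0 + 1)) windowStep

/-- Writes one value, updates the best ratio, and clears the memory cell. -/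
def writeStep : Prog :=
  .seq (.assign 3 (.reg 3 + .mem (.reg 15))) <|
    .seq (.store (.reg 15) 0) <|
      .seq (.output (.reg 3 - (.reg 2 + .reg 15))) <|
        .seq (.ite ((Expr.reg 4 * (.reg 2 + .reg 15 + 1)).lt
            ((.reg 3 - (.reg 2 + .reg 15)) * .reg 5))
          (.seq (.assign 4 (.reg 3 - (.reg 2 + .reg 15)))
            (.assign 5 (.reg 2 + .reg 15 + 1)))
          .skip) <|
          .assign 15 (.reg 15 + 1)

/-- Writes the values of the current block. -/
def writeBlock : Prog :=
  .seq (.assign 15 0) <|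
    .loop ((Expr.reg 15).lt (.reg 1) * (Expr.reg 2 + .reg 15).lt (.reg 0)) writeStep

/-- The whole program. -/
def main : Prog :=
  .seq (.assign 5 1) <|
    .seq (.loop ((Expr.reg 2).lt (.reg 0))
      (.seq histogram <| .seq writeBlock <| .assign 2 (.reg 2 + .reg 1))) <|
      .seq (.output (.reg 4)) (.output (.reg 5))

end SubstringProg

open SubstringCount SubstringProg

/-! ### The earlier occurrences of a window -/

/-- Words are long enough for the square of `2 (n + 1)`. -/
structure Roomy (w : ℕ) (T : List ℕ) : Prop where
  pos : 0 < w
  sq : 4 * ((T.length + 1) * (T.length + 1)) ≤ 2 ^ w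

theorem Roomy.linear {w : ℕ} {T : List ℕ} (h : Roomy w T) : 4 * (T.length + 1) ≤ 2 ^ w :=
  le_trans (by nlinarith) h.sq

section Test

variable {w M : ℕ} {T : List ℕ} {mem : ℕ → ℕ} {out : List ℕ}

theorem run_maxSuffixStep (hw : Roomy w T) (v : Vars) (h1 : v.s ≤ v.a) (h2 : 1 ≤ v.h)
    (h3 : v.a + v.h < v.e) (he : v.e ≤ T.length) (hL : LyndonPower (letter T) v.a v.h v.p)
    (hb : ∀ j, v.s ≤ j → j < v.a → LexLt (letter T) v.e j v.a) :
    Run w M T maxSuffixStep (v.state mem out) fun s' t => ∃ a h p,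
      s' = Vars.state { v with a := a, h := h, p := p } mem out ∧
        (v.s ≤ a ∧ 1 ≤ h ∧ a + h ≤ v.e ∧ LyndonPower (letter T) a h p ∧
          ∀ j, v.s ≤ j → j < a → LexLt (letter T) v.e j a) ∧
        2 * v.a + v.h < 2 * a + h ∧ t ≤ 50 := by
  have hW := hw.linear
  have hp := hL.pos
  have hp' := hL.le
  refine run_ite ?_ (fun hc => ?_) fun hc => ?_
  · simp [legal_eq hw.pos]
    omega
  · simp at hc
    refine run_set (by norm_num) ?_ ?_
    · simp [legal_one hw.pos]
      omega
    · exact ⟨v.a, v.h + 1, v.p, rfl, ⟨h1, by omega, h3, hL.succ_of_eq hc, hb⟩, by omega,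
        by simp⟩
  simp at hc
  refine run_ite ?_ (fun hlt => ?_) fun hge => ?_
  · simp [legal_lt hw.pos]
    omega
  · simp at hlt
    refine run_seq (run_set (by norm_num) ?_ (run_set (by norm_num) ?_ ?_))
    · simp [legal_one hw.pos]
      omega
    · simp
    · exact ⟨v.a, v.h + 1, v.h + 1, rfl, ⟨h1, by omega, h3, hL.succ_of_lt hlt, hb⟩, by omega,
        by simp⟩
  simp at hge
  have hgt : letter T (v.a + (v.h - v.p)) < letter T (v.a + v.h) :=
    lt_of_le_of_ne hge (Ne.symm hc)
  have key : ∀ j, v.a ≤ j → j < v.a + v.p → LexLt (letter T) v.e j (v.a + v.p) :=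
    fun j hj hj' => (hL.lexLt_of_lt h2 hgt hj hj').mono h3
  have hb' : ∀ j, v.s ≤ j → j < v.a + v.p → LexLt (letter T) v.e j (v.a + v.p) := by
    intro j hj hj'
    rcases Nat.lt_or_ge j v.a with h | h
    · exact (hb j hj h).trans (key v.a le_rfl (by omega))
    · exact key j h hj'
  refine run_seq (run_set (by norm_num) ?_ (run_ite ?_ (fun hlt => ?_) fun hle => ?_))
  · simp
    omega
  · simp [legal_lt hw.pos, Vars.set]
    omega
  · simp [Vars.set] at hlt
    refine run_seq (run_set (by norm_num) (legal_one hw.pos)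
      (run_set (by norm_num) (legal_one hw.pos) ?_))
    exact ⟨v.a + v.p, 1, 1, rfl, ⟨by omega, le_rfl, by omega, .one _ _ le_rfl, hb'⟩, by omega,
      by simp⟩
  · simp [Vars.set] at hle
    refine run_set (by norm_num) ?_ ?_
    · simp [Vars.set]
      omega
    · exact ⟨v.a + v.p, v.h - v.p, v.p, rfl, ⟨by omega, by omega, by omega,
        hL.dropPeriod hle, hb'⟩, by omega, by simp⟩

theorem run_maxSuffix (hw : Roomy w T) (v : Vars) (hs : v.s < v.e) (he : v.e ≤ T.length) :
    Run w M T maxSuffix (v.state mem out) fun s' t => ∃ a h p,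
      s' = Vars.state { v with a := a, h := h, p := p } mem out ∧
        IsMaxSuffix (letter T) v.s v.e a ∧ t ≤ 200 * (T.length + 1) := by
  have hW := hw.linear
  refine run_seq (run_set (by norm_num) (by simp) ?_)
  refine run_seq (run_set (by norm_num) (legal_one hw.pos) ?_)
  refine run_seq (run_set (by norm_num) (legal_one hw.pos) ?_)
  -- Each step increases `2 a + h`: a restart gives up fewer than `2 p` letters for a shift by `p`.
  refine (run_loop (fun x : ℕ × ℕ × ℕ =>
      Vars.state { v with a := x.1, h := x.2.1, p := x.2.2 } mem out)
    (fun ⟨a, h, p⟩ => v.s ≤ a ∧ 1 ≤ h ∧ a + h ≤ v.e ∧ LyndonPower (letter T) a h p ∧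
      ∀ j, v.s ≤ j → j < a → LexLt (letter T) v.e j a)
    (fun ⟨a, h, _⟩ => 3 * v.e - (2 * a + h)) 50 ?_ ?_ (v.s, 1, 1)
    ⟨le_rfl, le_rfl, hs, .one _ _ le_rfl, fun j h1 h2 => absurd h1 (not_le.mpr h2)⟩).mono ?_
  · rintro ⟨a, h, p⟩ ⟨h1, h2, h3, -⟩
    simp [legal_lt hw.pos]
    omega
  · rintro ⟨a, h, p⟩ ⟨h1, h2, h3, hL, hb⟩ hc
    simp at hc
    refine (run_maxSuffixStep hw { v with a := a, h := h, p := p } h1 h2 hc he hL hb).mono ?_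
    rintro _ t ⟨a', h', p', rfl, hI, hlt, ht⟩
    have := hI.2.2.1
    exact ⟨(a', h', p'), rfl, hI, by dsimp only at *; omega, ht⟩
  · rintro _ t ⟨⟨a, h, p⟩, rfl, ⟨h1, h2, h3, hL, hb⟩, hc, ht⟩
    simp at hc ht
    have hae : v.e = a + h := by omega
    refine ⟨a, h, p, rfl, ⟨h1, by omega, hb, hae ▸ hL.not_lexLt⟩, ?_⟩
    simp
    omega

/-- What is known during the search for an earlier occurrence of the window `x = uv`, with
maximal suffix `v` that starts at `a`: the first `h` letters of `v` match at `pos`; no earlier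
occurrence of `x` puts `v` at a position below `pos` or below `ok`; and in the case that all of `v`
matches, the first `m` letters of `u` match. -/
structure Searching (f : ℕ → ℕ) (s e a h p pos ok m found : ℕ) : Prop where
  start_le : a ≤ pos + s
  le : a + h ≤ e
  lyndon : LyndonPower f a h p
  suffix_eq : ∀ r < h, f (pos + r) = f (a + r)
  not_match : ∀ j, j + a < pos + s ∨ j + a < ok + s → ¬ ∀ r, s + r < e → f (j + r) = f (s + r)
  mode : 0 < m → a + h = e ∧ ok ≤ pos
  prefix_le : s + m ≤ a
  prefix_eq : ∀ r < m, f (pos - (a - s) + r) = f (s + r)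
  found_le : found ≤ 1
  repeats : 0 < found → Repeats f s e

/-- The shift by one period is correct at a mismatch. -/
theorem Searching.not_match_shift {f : ℕ → ℕ} {s e a h p pos ok m found : ℕ}
    (hS : Searching f s e a h p pos ok m found) (hsa : s ≤ a)
    (hpos : ∀ j, j + a = pos + s → ¬ ∀ r, s + r < e → f (j + r) = f (s + r)) :
    ∀ j, j + a < pos + p + s ∨ j + a < ok + s → ¬ ∀ r, s + r < e → f (j + r) = f (s + r) := by
  intro j hj hx
  have h1 := hS.start_le
  have h2 := hS.le
  have hj' : pos + s ≤ j + a := by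
    by_contra! hlt
    exact hS.not_match j (Or.inl hlt) hx
  have hok : ¬ j + a < ok + s := fun h => hS.not_match j (Or.inr h) hx
  have hne : j + a ≠ pos + s := fun h => hpos j h hx
  obtain ⟨t, ht, hne'⟩ := hS.lyndon.exists_ne hS.suffix_eq (d := j + a - (pos + s))
    (by omega) (by omega)
  refine hne' ?_
  have := hx (a - s + t) (by omega)
  rwa [show j + (a - s + t) = pos + (j + a - (pos + s)) + t by omega,
    show s + (a - s + t) = a + t by omega] at this

theorem run_shift (hw : Roomy w T) (v : Vars) (hsa : v.s ≤ v.a) (he : v.e ≤ T.length)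
    (hpos : v.pos < v.a)
    (hS : Searching (letter T) v.s v.e v.a v.h v.p v.pos v.ok 0 v.found)
    (hx : ∀ j, j + v.a = v.pos + v.s →
      ¬ ∀ r, v.s + r < v.e → letter T (j + r) = letter T (v.s + r)) :
    Run w M T shift (v.state mem out) fun s' t => ∃ h p pos,
      s' = Vars.state { v with h := h, p := p, pos := pos } mem out ∧
        Searching (letter T) v.s v.e v.a h p pos v.ok 0 v.found ∧
        2 * v.pos + v.h < 2 * pos + h ∧ pos ≤ 2 * T.length ∧ t ≤ 30 := by
  have hW := hw.linear
  have hp := hS.lyndon.pos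
  have hp' := hS.lyndon.le
  have h1 := hS.start_le
  have h2 := hS.le
  have hn := hS.not_match_shift hsa hx
  refine run_seq (run_set (by norm_num) ?_ (run_ite ?_ (fun hlt => ?_) fun hle => ?_))
  · simp
    omega
  · simp [legal_lt hw.pos, Vars.set]
    omega
  · simp [Vars.set] at hlt
    refine run_seq (run_set (by norm_num) legal_zero
      (run_set (by norm_num) (legal_one hw.pos) ?_))
    refine ⟨0, 1, v.pos + v.p, rfl, ?_, by omega, by omega, by simp⟩
    exact { hS with
      start_le := by omega
      le := by omega
      lyndon := .one _ _ (by omega)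
      suffix_eq := by simp
      not_match := hn
      mode := by simp
      prefix_eq := by simp }
  · simp [Vars.set] at hle
    refine run_set (by norm_num) ?_ ?_
    · simp [Vars.set]
      omega
    · refine ⟨v.h - v.p, v.p, v.pos + v.p, rfl, ?_, by omega, by omega, by simp⟩
      exact { hS with
        start_le := by omega
        le := by omega
        lyndon := hS.lyndon.truncate (by omega) (by omega)
        suffix_eq := fun r hr => by
          rw [add_assoc, hS.suffix_eq (v.p + r) (by omega), hS.lyndon.period r (by omega)]
        not_match := hn
        mode := by simp
        prefix_eq := by simp }

theorem run_searchStep (hw : Roomy w T) (v : Vars) (he : v.e ≤ T.length)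
    (hM : IsMaxSuffix (letter T) v.s v.e v.a) (hpos : v.pos < v.a) (hfound : v.found = 0)
    (hok : v.ok ≤ 2 * T.length)
    (hS : Searching (letter T) v.s v.e v.a v.h v.p v.pos v.ok v.m v.found) :
    Run w M T searchStep (v.state mem out) fun s' t => ∃ h p pos ok m found,
      s' = Vars.state { v with h := h, p := p, pos := pos, ok := ok, m := m, found := found }
          mem out ∧
        (Searching (letter T) v.s v.e v.a h p pos ok m found ∧ pos ≤ 2 * T.length ∧
          ok ≤ 2 * T.length) ∧
        2 * v.pos + v.h + v.ok + v.m + v.found < 2 * pos + h + ok + m + found ∧ t ≤ 70 := by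
  have hW := hw.linear
  have hsa := hM.le
  have hae := hM.lt
  have hp := hS.lyndon.pos
  have hp' := hS.lyndon.le
  have h1 := hS.start_le
  have h2 := hS.le
  have h3 := hS.prefix_le
  have hshift : v.m = 0 → (∀ j, j + v.a = v.pos + v.s →
      ¬ ∀ r, v.s + r < v.e → letter T (j + r) = letter T (v.s + r)) →
      Run w M T shift (v.state mem out) fun s' t => ∃ h p pos ok m found,
        s' = Vars.state { v with h := h, p := p, pos := pos, ok := ok, m := m, found := found }
          mem out ∧
        (Searching (letter T) v.s v.e v.a h p pos ok m found ∧ pos ≤ 2 * T.length ∧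
          ok ≤ 2 * T.length) ∧
        2 * v.pos + v.h + v.ok + v.m + v.found < 2 * pos + h + ok + m + found ∧ t ≤ 30 := by
    intro hm hx
    refine (run_shift hw v hsa he hpos (hm ▸ hS) hx).mono ?_
    rintro _ t ⟨h, p, pos, rfl, hS', hlt, hle, ht⟩
    exact ⟨h, p, pos, v.ok, v.m, v.found, rfl, ⟨hm ▸ hS', hle, hok⟩, by omega, ht⟩
  refine run_ite ?_ (fun hc => ?_) fun hc => ?_
  · simp [legal_lt hw.pos]
    omega
  · simp at hc
    have hm : v.m = 0 := by
      have := hS.mode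
      omega
    refine run_ite ?_ (fun heq => ?_) fun hne => ?_
    · simp [legal_eq hw.pos]
      omega
    · simp at heq
      have hmatch : ∀ r < v.h + 1, letter T (v.pos + r) = letter T (v.a + r) := by
        intro r hr
        rcases Nat.lt_succ_iff_lt_or_eq.mp hr with hr | rfl
        · exact hS.suffix_eq r hr
        · exact heq
      refine run_ite ?_ (fun heq' => ?_) fun hne' => ?_
      · simp [legal_eq hw.pos]
        omega
      · simp at heq'
        refine run_set (by norm_num) ?_ ?_
        · simp [legal_one hw.pos]
          omega
        · exact ⟨v.h + 1, v.p, v.pos, v.ok, v.m, v.found, rfl, ⟨{ hS with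
            le := hc
            lyndon := hS.lyndon.succ_of_eq heq'
            suffix_eq := hmatch
            mode := by omega }, by omega, hok⟩, by omega, by simp⟩
      · simp at hne'
        refine run_seq (run_set (by norm_num) ?_ (run_set (by norm_num) ?_ ?_))
        · simp [legal_one hw.pos]
          omega
        · simp
        · exact ⟨v.h + 1, v.h + 1, v.pos, v.ok, v.m, v.found, rfl, ⟨{ hS with
            le := hc
            lyndon := hS.lyndon.succ_of_lt
              (lt_of_le_of_ne (hM.le_of_lyndonPower hS.lyndon hc) hne')
            suffix_eq := hmatch
            mode := by omega }, by omega, hok⟩, by omega, by simp⟩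
    · simp at hne
      refine (hshift hm fun j hj hx => hne ?_).mono ?_
      · have := hx (v.a - v.s + v.h) (by omega)
        rwa [show j + (v.a - v.s + v.h) = v.pos + v.h by omega,
          show v.s + (v.a - v.s + v.h) = v.a + v.h by omega] at this
      · rintro s' t ⟨h, p, pos, ok, m, found, hs', hI, hlt, ht⟩
        exact ⟨h, p, pos, ok, m, found, hs', hI, hlt, by simp; omega⟩
  simp at hc
  have hae : v.a + v.h = v.e := by omega
  refine run_ite ?_ (fun hlt => ?_) fun hge => ?_
  · simp [legal_lt hw.pos]
  · simp at hlt
    refine (hshift (by have := hS.mode; omega)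
      fun j hj => hS.not_match j (Or.inr (by omega))).mono ?_
    rintro s' t ⟨h, p, pos, ok, m, found, hs', hI, hlt, ht⟩
    exact ⟨h, p, pos, ok, m, found, hs', hI, hlt, by simp; omega⟩
  simp at hge
  refine run_ite ?_ (fun hm => ?_) fun hm => ?_
  · simp [legal_lt hw.pos]
    omega
  · simp at hm
    refine run_ite ?_ (fun heq => ?_) fun hne => ?_
    · simp [legal_eq hw.pos]
      omega
    · simp at heq
      refine run_set (by norm_num) ?_ ?_
      · simp [legal_one hw.pos]
        omega
      · refine ⟨v.h, v.p, v.pos, v.ok, v.m + 1, v.found, rfl, ⟨{ hS with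
            mode := fun _ => ⟨hae, hge⟩
            prefix_le := hm
            prefix_eq := fun r hr => ?_ }, by omega, hok⟩, by omega, by simp⟩
        rcases Nat.lt_succ_iff_lt_or_eq.mp hr with hr | rfl
        · exact hS.prefix_eq r hr
        · exact heq
    · simp at hne
      refine run_seq (run_set (by norm_num) ?_ (run_set (by norm_num) legal_zero ?_))
      · simp [legal_one hw.pos]
        omega
      · refine ⟨v.h, v.p, v.pos, v.pos + (v.a - v.s) + 1, 0, v.found, rfl, ⟨{ hS with
            not_match := fun j hj hx => ?_
            mode := by simp
            prefix_le := by omega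
            prefix_eq := by simp }, by omega, by omega⟩, by omega, by simp⟩
        rcases lt_trichotomy (j + v.a) (v.pos + v.s) with hlt | heq | hgt
        · exact hS.not_match j (Or.inl hlt) hx
        · refine hne ?_
          have := hx v.m (by omega)
          rwa [show j = v.pos - (v.a - v.s) by omega] at this
        · exact hM.not_match (fun r hr => hS.suffix_eq r (by omega)) hgt (by omega) hx
  · simp at hm
    refine run_set (by norm_num) (legal_one hw.pos) ?_
    refine ⟨v.h, v.p, v.pos, v.ok, v.m, 1, rfl, ⟨{ hS with
      found_le := le_rfl
      repeats := fun _ => ⟨v.pos - (v.a - v.s), by omega, fun r hr => ?_⟩ }, by omega, hok⟩,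
      by omega, by simp⟩
    rcases Nat.lt_or_ge r v.m with h | h
    · exact hS.prefix_eq r h
    · have := hS.suffix_eq (r - (v.a - v.s)) (by omega)
      rwa [show v.pos + (r - (v.a - v.s)) = v.pos - (v.a - v.s) + r by omega,
        show v.a + (r - (v.a - v.s)) = v.s + r by omega] at this

theorem run_search (hw : Roomy w T) (v : Vars) (he : v.e ≤ T.length)
    (hM : IsMaxSuffix (letter T) v.s v.e v.a) :
    Run w M T search (v.state mem out) fun s' t => ∃ h p pos ok m found,
      s' = Vars.state { v with h := h, p := p, pos := pos, ok := ok, m := m, found := found }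
          mem out ∧
        (found ≠ 0 ↔ Repeats (letter T) v.s v.e) ∧ t ≤ 1000 * (T.length + 1) := by
  have hW := hw.linear
  have hsa := hM.le
  have hae := hM.lt
  refine run_seq (run_set (by norm_num) legal_zero ?_)
  refine run_seq (run_set (by norm_num) (legal_one hw.pos) ?_)
  refine run_seq (run_set (by norm_num) ?_ ?_)
  · simp [Vars.set]
    omega
  refine run_seq (run_set (by norm_num) ?_ ?_)
  · simp [Vars.set]
    omega
  refine run_seq (run_set (by norm_num) legal_zero ?_)
  refine run_seq (run_set (by norm_num) legal_zero ?_)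
  simp only [Vars.set, val_zero, val_one, val_sub, val_reg, state_reg_a, state_reg_s]
  -- Each step increases `2 pos + h + ok + m + found`: a restart gives up fewer than `2 p` letters
  -- for a shift by `p`, and a failed comparison of `u` gives up `m ≤ |u|` letters and raises `ok`
  -- by more than `|u|`.
  refine (run_loop (fun x : ℕ × ℕ × ℕ × ℕ × ℕ × ℕ => Vars.state
      { v with
        h := x.1, p := x.2.1, pos := x.2.2.1, ok := x.2.2.2.1
        m := x.2.2.2.2.1, found := x.2.2.2.2.2 } mem out)
    (fun ⟨h, p, pos, ok, m, found⟩ => Searching (letter T) v.s v.e v.a h p pos ok m found ∧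
      pos ≤ 2 * T.length ∧ ok ≤ 2 * T.length)
    (fun ⟨h, _, pos, ok, m, found⟩ => 8 * T.length + 1 - (2 * pos + h + ok + m + found)) 70
    ?_ ?_ (0, 1, v.a - v.s, v.a - v.s, 0, 0) ⟨?_, by omega, by omega⟩).mono ?_
  · rintro ⟨h, p, pos, ok, m, found⟩ ⟨hS, h1, h2⟩
    exact legal_mul_of_le_one hw.pos (by simp [legal_lt hw.pos]) (by simp [legal_eq hw.pos])
      val_lt_le val_eq_le
  · rintro ⟨h, p, pos, ok, m, found⟩ ⟨hS, h1, h2⟩ hc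
    simp at hc
    refine (run_searchStep hw
      { v with h := h, p := p, pos := pos, ok := ok, m := m, found := found }
      he hM hc.1 hc.2 h2 hS).mono ?_
    rintro _ t ⟨h', p', pos', ok', m', found', rfl, hI, hlt, ht⟩
    refine ⟨(h', p', pos', ok', m', found'), rfl, hI, ?_, ht⟩
    have h3 := hI.1.le
    have h4 := hI.1.prefix_le
    have h5 := hI.1.found_le
    dsimp only at *
    omega
  · exact
      { start_le := by omega
        le := by omega
        lyndon := .one _ _ (by omega)
        suffix_eq := by simp
        not_match := fun j hj => by omega
        mode := by simp
        prefix_le := by omega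
        prefix_eq := by simp
        found_le := by omega
        repeats := by simp }
  · rintro _ t ⟨⟨h, p, pos, ok, m, found⟩, rfl, ⟨hS, h1, h2⟩, hc, ht⟩
    simp at hc ht
    refine ⟨h, p, pos, ok, m, found, rfl, ⟨fun h => hS.repeats (by omega), ?_⟩, ?_⟩
    · rintro ⟨j, hj, hx⟩ hf
      exact hS.not_match j (Or.inl (by omega)) hx
    · simp
      omega

end Test

/-! ### The histogram of repeat lengths -/

section Histogram

variable {w M : ℕ} {T : List ℕ} {mem : ℕ → ℕ} {out : List ℕ}

/-- The invariant of the two-pointer loop: the ends below `e` have been counted in the memory, and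
no factor that starts before `s` and ends at `e` has an earlier occurrence. The variables of the
outer loops are those of `v₀`. -/
structure Counting (T : List ℕ) (v₀ v : Vars) (mem : ℕ → ℕ) : Prop where
  n : v.n = v₀.n
  b : v.b = v₀.b
  k : v.k = v₀.k
  acc : v.acc = v₀.acc
  num : v.num = v₀.num
  den : v.den = v₀.den
  one_le : 1 ≤ v.e
  le_length : v.e ≤ T.length + 1
  start_le : v.s ≤ v.e
  not_repeats : ∀ i < v.s, ¬ Repeats (letter T) i v.e
  count : ∀ r < v₀.b, mem r = repCount (letter T) v.e (v₀.k + r)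

theorem run_windowStep (hw : Roomy w T) (v₀ v : Vars) (hM : v₀.b = M) (hb : v₀.b ≤ T.length)
    (hk : v₀.k ≤ T.length) (hC : Counting T v₀ v mem) (he : v.e ≤ T.length) :
    Run w M T windowStep (v.state mem out) fun s' t => ∃ (v' : Vars) (mem' : ℕ → ℕ),
      s' = v'.state mem' out ∧ Counting T v₀ v' mem' ∧ v.s + v.e < v'.s + v'.e ∧
        t ≤ 2000 * (T.length + 1) := by
  have hW := hw.linear
  have hse := hC.start_le
  have hvb := hC.b
  have hvk := hC.k
  have htest : Run w M T (.ite ((Expr.reg 6).lt (.reg 7)) (.seq maxSuffix search) .skip)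
      (Vars.state { v with found := 1 } mem out) fun s' t => ∃ a h p pos ok m found,
        s' = Vars.state { v with
          a := a, h := h, p := p, pos := pos, ok := ok, m := m, found := found } mem out ∧
          (found ≠ 0 ↔ (v.s < v.e → Repeats (letter T) v.s v.e)) ∧
          t ≤ 1300 * (T.length + 1) := by
    refine run_ite (by simp [legal_lt hw.pos]) (fun hc => ?_) fun hc => ?_
    · simp at hc
      refine run_seq ((run_maxSuffix hw { v with found := 1 } hc he).mono ?_)
      rintro _ t ⟨a, h, p, rfl, hM, ht⟩
      refine (run_search hw { v with found := 1, a := a, h := h, p := p } he hM).mono ?_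
      rintro _ t' ⟨h, p, pos, ok, m, found, rfl, hf, ht'⟩
      refine ⟨a, h, p, pos, ok, m, found, rfl, ?_, ?_⟩
      · exact hf.trans ⟨fun h _ => h, fun h => h hc⟩
      · simp
        omega
    · simp at hc
      refine run_skip ⟨v.a, v.h, v.p, v.pos, v.ok, v.m, 1, rfl, ?_, ?_⟩
      · exact ⟨fun _ h => absurd h (by omega), fun _ => one_ne_zero⟩
      · simp
        omega
  refine run_seq (run_set (by norm_num) (legal_one hw.pos) ?_)
  refine run_seq (htest.mono ?_)
  rintro _ t ⟨a, h, p, pos, ok, m, found, rfl, hf, ht⟩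
  refine run_ite legal_reg (fun hc => ?_) fun hc => ?_
  · simp at hc
    have hlen : repLength (letter T) v.e = v.e - v.s :=
      repLength_eq hC.not_repeats (hf.mp hc)
    have hnext : ∀ mem' t', (∀ r < v₀.b, mem' r = mem r +
          if repLength (letter T) v.e = v₀.k + r then 1 else 0) → t' ≤ 100 →
        Run w M T (.assign 7 (.reg 7 + 1)) (Vars.state { v with
          a := a, h := h, p := p, pos := pos, ok := ok, m := m, found := found } mem' out)
          fun s' t'' => ∃ (v' : Vars) (mem' : ℕ → ℕ),
            s' = v'.state mem' out ∧ Counting T v₀ v' mem' ∧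
            v.s + v.e < v'.s + v'.e ∧ t + (t' + t'') + 10 ≤ 2000 * (T.length + 1) := by
      intro mem' t' hmem ht'
      refine run_set (by norm_num) ?_ ⟨_, mem', rfl, { hC with
        one_le := ?_
        le_length := ?_
        start_le := ?_
        not_repeats := fun i hi hr => hC.not_repeats i hi (hr.end_anti (Nat.le_succ _))
        count := fun r hr => ?_ }, ?_, ?_⟩
      · simp [legal_one hw.pos]
        omega
      · simp [Vars.set]
      · simp [Vars.set]
        omega
      · simp [Vars.set]
        omega
      · simp [Vars.set]
        rw [hmem r hr, hC.count r hr, repCount_succ _ hC.one_le]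
      · simp [Vars.set]
      · simp
        omega
    refine run_seq (run_ite ?_ (fun hlt => ?_) fun hge => ?_)
    · simp [legal_lt hw.pos]
      omega
    · simp at hlt
      refine run_skip ((hnext mem 10 (fun r hr => ?_) (by omega)).mono ?_)
      · rw [if_neg (by omega), add_zero]
      · rintro _ t'' ⟨v', mem', rfl, hC', hlt', ht'⟩
        exact ⟨v', mem', rfl, hC', hlt', by simp; omega⟩
    simp at hge
    refine run_ite ?_ (fun hlt => ?_) fun hge' => ?_
    · simp [legal_lt hw.pos]
      omega
    · simp at hlt
      have hr : v.e - v.s - v.k < M := by omega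
      have hcnt := hC.count (v.e - v.s - v.k) (by omega)
      have hle := repCount_le (letter T) v.e (v₀.k + (v.e - v.s - v.k))
      refine run_put ?_ (by simpa using hr) ?_ ((hnext _ 40 (fun r hr => ?_) (by omega)).mono ?_)
      · simp
        omega
      · simp [legal_one hw.pos]
        omega
      · simp only [Function.update_apply, val_sub, val_reg, state_reg_e, state_reg_s, state_reg_k,
          val_add, val_mem, val_one, state_mem]
        by_cases hrr : r = v.e - v.s - v.k
        · rw [if_pos hrr, if_pos (by omega), hrr]
        · rw [if_neg hrr, if_neg (by omega), add_zero]
      · rintro _ t'' ⟨v', mem', rfl, hC', hlt', ht'⟩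
        exact ⟨v', mem', rfl, hC', hlt', by simp; omega⟩
    · simp at hge'
      refine run_skip ((hnext mem 30 (fun r hr => ?_) (by omega)).mono ?_)
      · rw [if_neg (by omega), add_zero]
      · rintro _ t'' ⟨v', mem', rfl, hC', hlt', ht'⟩
        exact ⟨v', mem', rfl, hC', hlt', by simp; omega⟩
  · simp at hc
    have hnot : ¬ (v.s < v.e → Repeats (letter T) v.s v.e) := fun h => hf.mpr h hc
    push Not at hnot
    refine run_set (by norm_num) ?_ ⟨_, mem, rfl, { hC with
        start_le := ?_
        not_repeats := fun i hi hr => ?_ }, ?_, ?_⟩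
    · simp [legal_one hw.pos]
      omega
    · simp [Vars.set]
      omega
    · rcases Nat.lt_succ_iff_lt_or_eq.mp hi with hi | rfl
      · exact hC.not_repeats i hi hr
      · exact hnot.2 hr
    · simp [Vars.set]
    · simp
      omega

theorem run_histogram (hw : Roomy w T) (v : Vars) (hn : v.n = T.length) (hM : v.b = M)
    (hb : v.b ≤ T.length) (hk : v.k ≤ T.length) (hmem : ∀ r < v.b, mem r = 0) :
    Run w M T histogram (v.state mem out) fun s' t =>
      ∃ (v' : Vars) (mem' : ℕ → ℕ), s' = v'.state mem' out ∧
      v'.n = v.n ∧ v'.b = v.b ∧ v'.k = v.k ∧ v'.acc = v.acc ∧ v'.num = v.num ∧ v'.den = v.den ∧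
      (∀ r < v.b, mem' r = repCount (letter T) (T.length + 1) (v.k + r)) ∧
      t ≤ 5000 * ((T.length + 1) * (T.length + 1)) := by
  have hW := hw.linear
  refine run_seq (run_set (by norm_num) legal_zero ?_)
  refine run_seq (run_set (by norm_num) (legal_one hw.pos) ?_)
  refine (run_loop (fun x : Vars × (ℕ → ℕ) => x.1.state x.2 out)
    (fun x => Counting T v x.1 x.2) (fun x => 2 * T.length + 2 - (x.1.s + x.1.e))
    (2000 * (T.length + 1)) ?_ ?_ ({ v with s := 0, e := 1 }, mem) ?_).mono ?_
  · rintro ⟨v', mem'⟩ hC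
    have := hC.n
    simp [legal_lt hw.pos, legal_one hw.pos]
    dsimp only at this
    omega
  · rintro ⟨v', mem'⟩ hC hc
    have hn' := hC.n
    simp at hc
    dsimp only at hn'
    refine (run_windowStep hw v v' hM hb hk hC (by omega)).mono ?_
    rintro _ t ⟨v'', mem'', rfl, hC', hlt, ht⟩
    have h1 := hC'.le_length
    have h2 := hC'.start_le
    exact ⟨(v'', mem''), rfl, hC', by dsimp only; omega, ht⟩
  · exact
      { n := rfl, b := rfl, k := rfl, acc := rfl, num := rfl, den := rfl
        one_le := le_rfl
        le_length := by simp
        start_le := by simp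
        not_repeats := by simp
        count := fun r hr => by rw [repCount_one]; exact hmem r hr }
  · rintro _ t ⟨⟨v', mem'⟩, rfl, hC, hc, ht⟩
    have hn' := hC.n
    have hle := hC.le_length
    simp at hc ht
    dsimp only at hn' hle
    have he : v'.e = T.length + 1 := by omega
    refine ⟨v', mem', rfl, hn', hC.b, hC.k, hC.acc, hC.num, hC.den,
      fun r hr => he ▸ hC.count r hr, ?_⟩
    simp only [size_zero, size_one]
    have : (2 * T.length + 2 - 1 + 1) * (5 + 1 + 2000 * (T.length + 1)) ≤
        (2 * (T.length + 1)) * (2006 * (T.length + 1)) := by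
      apply Nat.mul_le_mul <;> omega
    nlinarith

end Histogram

/-! ### Writing the values and the best ratio -/

section Write

variable {w M : ℕ} {T : List ℕ} {mem : ℕ → ℕ} {out : List ℕ}

/-- The values for the lengths `1, …, m` have been written, `acc` is the sum of the first `m`
entries of the histogram of repeat lengths, and `num / den` is the largest of the
ratios, or `0 / 1` if there is none. -/
structure Written (T : List ℕ) (m acc num den : ℕ) (out : List ℕ) : Prop where
  acc : acc = repCountLt (letter T) (T.length + 1) m
  out : out = (List.range m).map fun i => substringComplexity T (i + 1)
  attained : (num = 0 ∧ den = 1) ∨ (1 ≤ den ∧ den ≤ m ∧ num = substringComplexity T den)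
  max : ∀ k, 1 ≤ k → k ≤ m → substringComplexity T k * den ≤ num * k

theorem Written.zero (T : List ℕ) : Written T 0 0 0 1 [] where
  acc := (repCountLt_zero _ _).symm
  out := rfl
  attained := Or.inl ⟨rfl, rfl⟩
  max := fun k h1 h2 => by omega

theorem substringComplexity_succ_le {k : ℕ} (hk : k < T.length) :
    substringComplexity T (k + 1) ≤ T.length := by
  have h1 := substringComplexity_add T hk
  have h2 := repCountLt_le (fun i => T.getD i 0) (T.length + 1) (k + 1)
  omega

theorem Written.num_le {m acc num den : ℕ} (h : Written T m acc num den out)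
    (hm : m ≤ T.length) : num ≤ T.length := by
  rcases h.attained with h | ⟨h1, h2, h3⟩
  · omega
  · obtain ⟨k, rfl⟩ := Nat.exists_eq_add_of_le' h1
    exact h3 ▸ substringComplexity_succ_le (by omega)

theorem Written.den_le {m acc num den : ℕ} (h : Written T m acc num den out) :
    1 ≤ den ∧ den ≤ m + 1 := by
  rcases h.attained with h | h <;> omega

/-- The invariant of the loop that writes a block: `r` values of the block have been written and
their memory cells have been cleared. -/
structure Writing (T : List ℕ) (v₀ v : Vars) (mem : ℕ → ℕ) (out : List ℕ) : Prop where
  n : v.n = v₀.n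
  b : v.b = v₀.b
  k : v.k = v₀.k
  le_b : v.r ≤ v₀.b
  le_length : v₀.k + v.r ≤ T.length
  zero : ∀ i < v.r, mem i = 0
  count : ∀ i < v₀.b, v.r ≤ i → mem i = repCount (letter T) (T.length + 1) (v₀.k + i)
  written : Written T (v₀.k + v.r) v.acc v.num v.den out

theorem run_writeStep (hw : Roomy w T) (v₀ v : Vars) (hM : v₀.b = M)
    (hV : Writing T v₀ v mem out) (hr : v.r < v₀.b) (hkr : v₀.k + v.r < T.length) :
    Run w M T writeStep (v.state mem out) fun s' t => ∃ (v' : Vars) (mem' : ℕ → ℕ) (out' : List ℕ),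
      s' = v'.state mem' out' ∧ Writing T v₀ v' mem' out' ∧ v'.r = v.r + 1 ∧ t ≤ 100 := by
  have hW := hw.linear
  have hvk := hV.k
  have hvb := hV.b
  have hcount := hV.count v.r hr le_rfl
  have hwr := hV.written
  have hacc : v.acc + mem v.r = repCountLt (letter T) (T.length + 1) (v₀.k + v.r + 1) := by
    rw [hwr.acc, hcount, repCountLt_succ]
  have hadd : substringComplexity T (v.k + v.r + 1) + (v.k + v.r) = v.acc + mem v.r := by
    rw [hacc, hvk]
    exact substringComplexity_add T hkr
  have hval : v.acc + mem v.r - (v.k + v.r) = substringComplexity T (v.k + v.r + 1) := by omega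
  have hS : substringComplexity T (v.k + v.r + 1) ≤ T.length :=
    substringComplexity_succ_le (hvk ▸ hkr)
  have hnum := hwr.num_le hV.le_length
  have hden := hwr.den_le
  have hp1 : v.num * (v.k + v.r + 1) ≤ (T.length + 1) * (T.length + 1) :=
    Nat.mul_le_mul (by omega) (by omega)
  have hp2 : substringComplexity T (v.k + v.r + 1) * v.den ≤ (T.length + 1) * (T.length + 1) :=
    Nat.mul_le_mul (by omega) (by omega)
  have hsq := hw.sq
  set S := substringComplexity T (v.k + v.r + 1) with hSdef
  have hlast : ∀ num den t, ((num = v.num ∧ den = v.den ∧ S * v.den ≤ v.num * (v.k + v.r + 1)) ∨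
      (num = S ∧ den = v.k + v.r + 1 ∧ v.num * (v.k + v.r + 1) < S * v.den)) → t ≤ 95 →
      Run w M T (.assign 15 (.reg 15 + 1))
        (Vars.state { v with acc := v.acc + mem v.r, num := num, den := den }
          (Function.update mem v.r 0) (out ++ [S]))
        fun s' t' => ∃ (v' : Vars) (mem' : ℕ → ℕ) (out' : List ℕ),
          s' = v'.state mem' out' ∧ Writing T v₀ v' mem' out' ∧
          v'.r = v.r + 1 ∧ t + t' ≤ 100 := by
    intro num den t hbest ht
    refine run_set (by norm_num) ?_ ⟨_, _, _, rfl, ?_, rfl, by simp; omega⟩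
    · simp [legal_one hw.pos]
      omega
    · refine
        { n := hV.n, b := hvb, k := hvk
          le_b := hr
          le_length := hkr
          zero := fun i hi => ?_
          count := fun i hi hri => ?_
          written := ⟨hacc, ?_, ?_, fun k h1 h2 => ?_⟩ }
      · rcases Nat.lt_succ_iff_lt_or_eq.mp (show i < v.r + 1 from hi) with hi | rfl
        · rw [Function.update_of_ne hi.ne, hV.zero i hi]
        · exact Function.update_self v.r 0 mem
      · have hri' : v.r < i := hri
        rw [Function.update_of_ne hri'.ne', hV.count i hi hri'.le]
      · change out ++ [S] = (List.range (v₀.k + v.r + 1)).map _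
        rw [List.range_succ, List.map_append, ← hwr.out, hSdef, hvk]
        rfl
      · change (num = 0 ∧ den = 1) ∨
          (1 ≤ den ∧ den ≤ v₀.k + (v.r + 1) ∧ num = substringComplexity T den)
        rcases hbest with ⟨rfl, rfl, -⟩ | ⟨h1, h2, -⟩
        · rcases hwr.attained with h | ⟨h1, h2, h3⟩
          · exact Or.inl h
          · exact Or.inr ⟨h1, by omega, h3⟩
        · exact Or.inr ⟨by omega, by omega, by rw [h1, h2]⟩
      · change substringComplexity T k * den ≤ num * k
        replace h2 : k ≤ v₀.k + v.r + 1 := h2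
        rcases Nat.lt_or_ge k (v.k + v.r + 1) with hlt | hge
        · have hold := hwr.max k h1 (by omega)
          rcases hbest with ⟨rfl, rfl, -⟩ | ⟨rfl, rfl, hb⟩
          · exact hold
          · -- Here `S_k / k ≤ num / den < S / (k₀ + r + 1)`, with denominators cleared.
            have h3 : v.den * (substringComplexity T k * (v.k + v.r + 1)) ≤
                v.den * (S * k) := by
              calc _ = substringComplexity T k * v.den * (v.k + v.r + 1) := by ring
                _ ≤ v.num * k * (v.k + v.r + 1) := Nat.mul_le_mul_right _ hold
                _ = v.num * (v.k + v.r + 1) * k := by ring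
                _ ≤ S * v.den * k := Nat.mul_le_mul_right _ hb.le
                _ = _ := by ring
            exact Nat.le_of_mul_le_mul_left h3 hden.1
        · obtain rfl : k = v.k + v.r + 1 := by omega
          rw [← hSdef]
          rcases hbest with ⟨rfl, rfl, hb⟩ | ⟨rfl, rfl, hb⟩
          · exact hb
          · exact le_rfl
  refine run_seq (run_set (by norm_num) ?_ ?_)
  · simp
    omega
  refine run_seq (run_put legal_reg ?_ legal_zero ?_)
  · simp [Vars.set]
    omega
  refine run_seq (run_write ?_ ?_)
  · simp [Vars.set]
    omega
  simp only [Vars.set, val_zero, val_sub, val_add, val_reg, val_mem, state_mem,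
    state_reg_acc, state_reg_k, state_reg_r, hval]
  refine run_seq (run_ite ?_ (fun hlt => ?_) fun hge => ?_)
  · simp [legal_lt hw.pos, legal_one hw.pos, hval]
    omega
  · simp [hval] at hlt
    refine run_seq (run_set (by norm_num) ?_ (run_set (by norm_num) ?_ ?_))
    · simp
      omega
    · simp [Vars.set, legal_one hw.pos]
      omega
    · simp only [Vars.set, val_one, val_sub, val_add, val_reg, state_reg_acc, state_reg_k,
        state_reg_r, hval]
      refine (hlast _ _ 60 (Or.inr ⟨rfl, rfl, hlt⟩) (by omega)).mono ?_
      rintro _ t ⟨v', mem', out', rfl, hV', hr', ht⟩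
      exact ⟨v', mem', out', rfl, hV', hr', by simp; omega⟩
  · simp [hval] at hge
    refine run_skip ((hlast _ _ 60 (Or.inl ⟨rfl, rfl, hge⟩) (by omega)).mono ?_)
    rintro _ t ⟨v', mem', out', rfl, hV', hr', ht⟩
    exact ⟨v', mem', out', rfl, hV', hr', by simp; omega⟩

theorem run_writeBlock (hw : Roomy w T) (v : Vars) (hn : v.n = T.length) (hM : v.b = M)
    (hb : v.b ≤ T.length) (hk : v.k ≤ T.length)
    (hmem : ∀ r < v.b, mem r = repCount (letter T) (T.length + 1) (v.k + r))
    (hwr : Written T v.k v.acc v.num v.den out) :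
    Run w M T writeBlock (v.state mem out) fun s' t => ∃ (v' : Vars) (mem' : ℕ → ℕ) (out' : List ℕ),
      s' = v'.state mem' out' ∧ v'.n = v.n ∧ v'.b = v.b ∧ v'.k = v.k ∧
      (v.k + v.b < T.length → ∀ r < v.b, mem' r = 0) ∧
      Written T (min (v.k + v.b) T.length) v'.acc v'.num v'.den out' ∧
      t ≤ 200 * (T.length + 1) := by
  have hW := hw.linear
  refine run_seq (run_set (by norm_num) legal_zero ?_)
  refine (run_loop (fun x : Vars × (ℕ → ℕ) × List ℕ => x.1.state x.2.1 x.2.2)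
    (fun x => Writing T v x.1 x.2.1 x.2.2) (fun x => v.b - x.1.r) 100
    ?_ ?_ ({ v with r := 0 }, mem, out) ?_).mono ?_
  · rintro ⟨v', mem', out'⟩ hV
    have h1 := hV.k
    have h2 := hV.le_length
    refine legal_mul_of_le_one hw.pos (by simp [legal_lt hw.pos]) ?_ val_lt_le val_lt_le
    simp [legal_lt hw.pos]
    dsimp only at *
    omega
  · rintro ⟨v', mem', out'⟩ hV hc
    have h1 := hV.k
    have h2 := hV.n
    have h3 := hV.b
    simp at hc
    dsimp only at *
    refine (run_writeStep hw v v' hM hV (by omega) (by omega)).mono ?_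
    rintro _ t ⟨v'', mem'', out'', rfl, hV', hr, ht⟩
    exact ⟨(v'', mem'', out''), rfl, hV', by dsimp only; omega, ht⟩
  · exact
      { n := rfl, b := rfl, k := rfl
        le_b := Nat.zero_le _
        le_length := hk
        zero := fun i hi => absurd hi (Nat.not_lt_zero _)
        count := fun i hi _ => hmem i hi
        written := hwr }
  · rintro _ t ⟨⟨v', mem', out'⟩, rfl, hV, hc, ht⟩
    have h1 := hV.k
    have h2 := hV.n
    have h3 := hV.b
    have h4 := hV.le_b
    have h5 := hV.le_length
    simp at hc ht
    dsimp only at *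
    have hmin : min (v.k + v.b) T.length = v.k + v'.r := by omega
    have hclear : v.k + v.b < T.length → ∀ r < v.b, mem' r = 0 := fun hlt r hr =>
      hV.zero r (show r < v'.r by omega)
    refine ⟨v', mem', out', rfl, h2, h3, h1, hclear, hmin ▸ hV.written, ?_⟩
    simp
    omega

end Write

/-! ### The whole program -/

/-- The invariant of the outer loop. Only the last block can be incomplete, so the number of
values that have been written is `min k n`. -/
structure Blocks (T : List ℕ) (b : ℕ) (v : Vars) (mem : ℕ → ℕ) (out : List ℕ) : Prop where
  n_eq : v.n = T.length
  b_eq : v.b = b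
  clear : v.k < T.length → ∀ r < b, mem r = 0
  written : Written T (min v.k T.length) v.acc v.num v.den out

theorem run_main {w b : ℕ} {T : List ℕ} (hw : Roomy w T) (hb : 1 ≤ b) (hbn : b ≤ T.length) :
    Run w b T main (State.init T.length b) fun s' t => ∃ acc num den out,
      s'.out = out ++ [num, den] ∧ Written T T.length acc num den out ∧
        t * b ≤ 100000 * T.length ^ 3 := by
  have hW := hw.linear
  have hinit : State.init T.length b =
      Vars.state ⟨T.length, b, 0, 0, 0, 0, 0, 0, 0, 0, 0, 0, 0, 0, 0, 0⟩ (fun _ => 0) [] := by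
    rw [State.init, Vars.state, State.mk.injEq]
    refine ⟨funext fun r => ?_, rfl, rfl⟩
    by_cases hr : r < 16
    · interval_cases r <;> rfl
    · obtain ⟨r, rfl⟩ := Nat.exists_eq_add_of_le' (not_lt.mp hr)
      rfl
  rw [hinit]
  set N := T.length + 1 with hN
  refine run_seq (run_set (by norm_num) (legal_one hw.pos) ?_)
  refine run_seq ((run_loop (fun x : Vars × (ℕ → ℕ) × List ℕ => x.1.state x.2.1 x.2.2)
    (fun x => Blocks T b x.1 x.2.1 x.2.2) (fun x => (T.length - x.1.k + (b - 1)) / b)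
    (5300 * (N * N)) ?_ ?_
    (⟨T.length, b, 0, 0, 0, 1, 0, 0, 0, 0, 0, 0, 0, 0, 0, 0⟩, fun _ => 0, []) ?_).mono ?_)
  · rintro ⟨v, mem, out⟩ -
    simp [legal_lt hw.pos]
  · rintro ⟨v, mem, out⟩ hI hc
    obtain ⟨hn, hvb, hclear, hwr⟩ := hI
    simp at hc
    dsimp only at *
    rw [hn] at hc
    refine run_seq ((run_histogram hw v hn hvb (hvb ▸ hbn) hc.le
      (hvb ▸ hclear hc)).mono ?_)
    rintro _ t₁ ⟨v₁, mem₁, rfl, hn₁, hb₁, hk₁, hacc₁, hnum₁, hden₁, hmem₁, ht₁⟩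
    refine run_seq ((run_writeBlock hw v₁ (hn₁.trans hn) (hb₁.trans hvb)
      (by omega) (by omega) (by rwa [hb₁, hk₁]) ?_).mono ?_)
    · rw [hk₁, hacc₁, hnum₁, hden₁]
      rwa [min_eq_left hc.le] at hwr
    rintro _ t₂ ⟨v₂, mem₂, out₂, rfl, hn₂, hb₂, hk₂, hclear₂, hwr₂, ht₂⟩
    refine run_set (by norm_num) ?_ ⟨(_, mem₂, out₂), rfl, ⟨?_, ?_, ?_, ?_⟩, ?_, ?_⟩
    · simp
      omega
    · exact hn₂.trans (hn₁.trans hn)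
    · exact hb₂.trans (hb₁.trans hvb)
    · simp
      rw [hk₂, hb₂]
      intro h r hr
      exact hclear₂ h r (by omega)
    · simp
      rwa [hk₂, hb₂]
    · simp
      rw [hk₂, hk₁, hb₂, hb₁, hvb]
      -- The quotient drops because its numerator drops by `b`, or to less than `b`.
      rcases Nat.lt_or_ge (T.length - v.k) b with h | h
      · rw [Nat.sub_eq_zero_of_le (by omega), Nat.div_eq_of_lt (by omega)]
        exact Nat.div_pos (by omega) (by omega)
      · rw [show T.length - v.k + (b - 1) = T.length - (v.k + b) + (b - 1) + b by omega,
          Nat.add_div_right _ (by omega)]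
        exact Nat.lt_succ_self _
    · have : N ≤ N * N := Nat.le_mul_self N
      rw [← hN] at ht₁ ht₂
      simp
      omega
  · exact ⟨rfl, rfl, fun _ _ _ => rfl, by simpa using Written.zero T⟩
  · rintro _ t ⟨⟨v, mem, out⟩, rfl, hI, hc, ht⟩
    obtain ⟨hn, hvb, -, hwr⟩ := hI
    simp at hc ht
    dsimp only at *
    rw [min_eq_right (by omega)] at hwr
    refine run_seq (run_write legal_reg (run_write legal_reg ?_))
    refine ⟨v.acc, v.num, v.den, out, by simp, hwr, ?_⟩
    simp
    have hq : ((T.length + (b - 1)) / b + 1) * b ≤ 3 * T.length := by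
      have := Nat.div_mul_le_self (T.length + (b - 1)) b
      rw [add_mul]
      omega
    have h1 : N ≤ 2 * T.length := by omega
    have h2 : N * N ≤ 4 * T.length ^ 2 := by nlinarith
    have h3 : 1 ≤ T.length ^ 2 := Nat.one_le_pow _ _ (by omega)
    have h4 : ((T.length + (b - 1)) / b + 1) * (4 + 5300 * (N * N)) ≤
        ((T.length + (b - 1)) / b + 1) * (5304 * (N * N)) := by
      have : 1 ≤ N * N := Nat.mul_pos (by omega) (by omega)
      exact Nat.mul_le_mul_left _ (by omega)
    calc _ ≤ (((T.length + (b - 1)) / b + 1) * (5304 * (N * N)) + 8) * b :=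
          Nat.mul_le_mul_right _ (by omega)
      _ = (((T.length + (b - 1)) / b + 1) * b) * (5304 * (N * N)) + 8 * b := by ring
      _ ≤ (3 * T.length) * (5304 * (4 * T.length ^ 2)) + 8 * (T.length * T.length ^ 2) := by
        gcongr
        nlinarith
      _ ≤ _ := by nlinarith

/-- Words of `(c + 4) (⌊log₂ n⌋ + 1)` bits suffice for the computation and hold the letters. -/
theorem roomy_of_log {T : List ℕ} (c : ℕ) (hT : 1 ≤ T.length) :
    Roomy ((c + 4) * (Nat.log 2 T.length + 1)) T ∧
      T.length ^ c < 2 ^ ((c + 4) * (Nat.log 2 T.length + 1)) := by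
  set n := T.length
  set B := 2 ^ (Nat.log 2 n + 1) with hB
  have hn : n < B := Nat.lt_pow_succ_log_self (by norm_num) n
  have hpow : 2 ^ ((c + 4) * (Nat.log 2 n + 1)) = B ^ c * B ^ 4 := by
    rw [← pow_add, hB, ← pow_mul, mul_comm]
  have hc : 1 ≤ B ^ c := Nat.one_le_pow _ _ (by omega)
  have h2 : 4 ≤ B * B := Nat.mul_le_mul (show 2 ≤ B by omega) (show 2 ≤ B by omega)
  have hB4 : B ^ 4 = B * B * (B * B) := by ring
  refine ⟨⟨by positivity, ?_⟩, ?_⟩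
  · rw [hpow, hB4]
    calc 4 * ((n + 1) * (n + 1)) ≤ B * B * (B * B) := by gcongr <;> exact hn
      _ ≤ _ := Nat.le_mul_of_pos_left _ hc
  · rw [hpow]
    calc n ^ c ≤ B ^ c := Nat.pow_le_pow_left hn.le c
      _ < B ^ c * B ^ 4 := lt_mul_of_one_lt_right hc (by rw [hB4]; nlinarith)

end WordRAM

/-- There are one program `P` and one constant `C` such that for every string `T` of length `n` over
`{1, …, n ^ c}` and every `b ∈ [1, n]`, the program writes `S_T(1), …, S_T(n)` and then `δ`, as a
fraction `p / q`, in at most `C n³ / b` time and with at most `C b` words of space, every word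
having `K (⌊log₂ n⌋ + 1)` bits, where `K` depends only on `c`. -/
theorem proposition1 :
    ∃ (P : WordRAM.Prog) (C : ℕ), ∀ c : ℕ, ∃ K : ℕ, ∀ (T : List ℕ) (b : ℕ),
      1 ≤ b → b ≤ T.length → (∀ a ∈ T, 1 ≤ a ∧ a ≤ T.length ^ c) →
      ∃ M t p q : ℕ,
        P.Computes (K * (Nat.log 2 T.length + 1)) M T b t
          ((List.range T.length).map (fun i => substringComplexity T (i + 1)) ++ [p, q]) ∧
        0 < q ∧ delta T = (p : ℝ) / q ∧
        (t : ℝ) ≤ C * ((T.length : ℝ) ^ 3 / b) ∧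
        P.size + M ≤ C * b := by
  refine ⟨WordRAM.SubstringProg.main, 100000 + WordRAM.SubstringProg.main.size,
    fun c => ⟨c + 4, ?_⟩⟩
  intro T b hb hbn hT
  obtain ⟨hw, hpow⟩ := WordRAM.roomy_of_log c (hb.trans hbn)
  obtain ⟨s, t, hex, acc, p, q, out, hout, hwr, ht⟩ := WordRAM.run_main hw hb hbn
  have hW := hw.linear
  have hq := hwr.den_le
  have hbpos : (0 : ℝ) < b := by exact_mod_cast hb
  refine ⟨b, t, p, q, ⟨by omega, by omega, fun a ha => (hT a ha).2.trans_lt hpow, s, hex, ?_⟩,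
    hq.1, SubstringCount.delta_eq_div hq.1 ?_ hwr.max, ?_, ?_⟩
  · rw [hout, hwr.out]
  ·
    rcases hwr.attained with ⟨rfl, rfl⟩ | h
    · have h1 := hwr.max 1 le_rfl (hb.trans hbn)
      have h2 := SubstringCount.substringComplexity_add T (k := 0) (by omega)
      omega
    · exact h.2.2
  · rw [← mul_div_assoc, le_div_iff₀ hbpos]
    calc (t : ℝ) * b ≤ 100000 * (T.length : ℝ) ^ 3 := by exact_mod_cast ht
      _ ≤ _ := by
        gcongr
        push_cast
        linarith [Nat.cast_nonneg (α := ℝ) WordRAM.SubstringProg.main.size]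
  · have : WordRAM.SubstringProg.main.size ≤ WordRAM.SubstringProg.main.size * b :=
      Nat.le_mul_of_pos_right _ hb
    rw [add_mul]
    omega
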